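/- Let $\omega\in\mathbb{R}$ with $|\omega|<\frac23$. For complex-valued $u,v\in H^1(\mathbb{R})$ put $$J[u,v]=\int_{\mathbb{R}}3\left(|u|^4+|v|^4+4|u|^2|v|^2\right)+4\,\Re[\bar u^3v]\,dx,$$ $$I[u,v]=\int_{\mathbb{R}}|u'|^2+|v'|^2+(4-\omega^2)|u|^2+(4-9\omega^2)|v|^2\,dx.$$ Then the problem of maximizing $J[u,v]$ subject to $I[u,v]=1$ has a solution $(U,V)$ with $U,V$ real-valued, smooth and even, $U\ge 0$, $V\ge 0$; that is, $I[U,V]=1$ and $J[U,V]=\max_{I[u,v]=1}J[u,v]$. Moreover, with $$J_0:=2\sup_{I[u,v]=1}J[u,v]=2J[U,V]>0,$$ the pair $(U,V)$ satisfies the Euler--Lagrange system $$-U''+(4-\omega^2)U-\frac1{J_0}\left(6U^3+12V^2U+6U^2V\right)=0,$$ $$-V''+(4-9\omega^2)V-\frac1{J_0}\left(6V^3+12U^2V+2U^3\right)=0.$$ Finally, let $$\mathcal{L}=\begin{pmatrix}\mathcal{L}_1&0&-\frac{24}{J_0}UV-\frac6{J_0}U^2&0\\0&\mathcal{L}_2&0&-\frac6{J_0}U^2\\-\frac{24}{J_0}UV-\frac6{J_0}U^2&0&\mathcal{L}_3&0\\0&-\frac6{J_0}U^2&0&\mathcal{L}_4\end{pmatrix},$$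 $$\mathcal{L}_1=-\partial_{xx}+(4-\omega^2)-\tfrac{18}{J_0}U^2-\tfrac{12}{J_0}V^2-\tfrac{12}{J_0}UV,\qquad \mathcal{L}_2=-\partial_{xx}+(4-\omega^2)-\tfrac{6}{J_0}U^2-\tfrac{12}{J_0}V^2+\tfrac{12}{J_0}UV,$$ $$\mathcal{L}_3=-\partial_{xx}+(4-9\omega^2)-\tfrac{18}{J_0}V^2-\tfrac{12}{J_0}U^2,\qquad \mathcal{L}_4=-\partial_{xx}+(4-9\omega^2)-\tfrac{6}{J_0}V^2-\tfrac{12}{J_0}U^2,$$ acting on real-valued vectors in $H^2(\mathbb{R})^4$. The vector $n:=(-U''+(4-\omega^2)U,\,0,\,-V''+(4-9\omega^2)V,\,0)$ is a nonzero element of $L^2(\mathbb{R})^4$, and $\langle\mathcal{L}h,h\rangle_{L^2}\ge 0$ for every real-valued $h\in H^2(\mathbb{R})^4$ with $\langle h,n\rangle_{L^2}=0$. -/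

import Mathlib

open MeasureTheory

namespace Oscillon

noncomputable section

/-- `g` is a weak derivative of `f` on the real line (both locally integrable). -/
def HasWeakDeriv {E : Type*} [NormedAddCommGroup E] [NormedSpace ℝ E] (f g : ℝ → E) : Prop :=
  LocallyIntegrable f ∧ LocallyIntegrable g ∧
    ∀ φ : ℝ → ℝ, ContDiff ℝ (⊤ : ℕ∞) φ → HasCompactSupport φ →
      ∫ x, deriv φ x • f x = - ∫ x, φ x • g x

open Classical in
/-- The weak derivative of `f` (unique up to null sets), and `0` if there is none. -/
def weakDeriv {E : Type*} [NormedAddCommGroup E] [NormedSpace ℝ E] (f : ℝ → E) : ℝ → E :=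
  if h : ∃ g, HasWeakDeriv f g then h.choose else 0

/-- The Sobolev space `H¹(ℝ)`. -/
def MemH1 {E : Type*} [NormedAddCommGroup E] [NormedSpace ℝ E] (f : ℝ → E) : Prop :=
  MemLp f 2 ∧ ∃ g, MemLp g 2 ∧ HasWeakDeriv f g

/-- The Sobolev space `H²(ℝ)`. -/
def MemH2 {E : Type*} [NormedAddCommGroup E] [NormedSpace ℝ E] (f : ℝ → E) : Prop :=
  MemH1 f ∧ MemH1 (weakDeriv f)

/-- `J[u,v] = ∫ 3(|u|⁴ + |v|⁴ + 4|u|²|v|²) + 4 Re(ū³ v)`. -/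
def J (u v : ℝ → ℂ) : ℝ :=
  ∫ x, (3 * (‖u x‖ ^ 4 + ‖v x‖ ^ 4 + 4 * ‖u x‖ ^ 2 * ‖v x‖ ^ 2)
    + 4 * ((starRingEnd ℂ (u x)) ^ 3 * v x).re)

/-- `I[u,v] = ∫ |u'|² + |v'|² + (4-ω²)|u|² + (4-9ω²)|v|²`. -/
def I (ω : ℝ) (u v : ℝ → ℂ) : ℝ :=
  ∫ x, (‖weakDeriv u x‖ ^ 2 + ‖weakDeriv v x‖ ^ 2
    + (4 - ω ^ 2) * ‖u x‖ ^ 2 + (4 - 9 * ω ^ 2) * ‖v x‖ ^ 2)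

/-- The pairs `(u, v)` of complex-valued `H¹` functions with `I[u,v] = 1`. -/
def admissible (ω : ℝ) : Set ((ℝ → ℂ) × (ℝ → ℂ)) :=
  {w | MemH1 w.1 ∧ MemH1 w.2 ∧ I ω w.1 w.2 = 1}

/-- The set of values of `J` under the constraint `I = 1`. -/
def values (ω : ℝ) : Set ℝ :=
  (fun w : (ℝ → ℂ) × (ℝ → ℂ) => J w.1 w.2) '' admissible ω

/-- A real-valued function as a complex-valued one. -/
def toC (f : ℝ → ℝ) : ℝ → ℂ := fun x => (f x : ℂ)

/-- The (real) `L²(ℝ)⁴` inner product. -/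
def inner4 (f g : Fin 4 → ℝ → ℝ) : ℝ := ∫ x, ∑ i, f i x * g i x

/-- The linearized operator `ℒ`, on real vectors `(p, q, r, s)` of `H²` functions. -/
def linOp (ω J₀ : ℝ) (U V : ℝ → ℝ) (h : Fin 4 → ℝ → ℝ) : Fin 4 → ℝ → ℝ :=
  ![fun x => -weakDeriv (weakDeriv (h 0)) x + (4 - ω ^ 2) * h 0 x
      - (18 / J₀ * U x ^ 2 + 12 / J₀ * V x ^ 2 + 12 / J₀ * (U x * V x)) * h 0 x
      - (24 / J₀ * (U x * V x) + 6 / J₀ * U x ^ 2) * h 2 x,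
    fun x => -weakDeriv (weakDeriv (h 1)) x + (4 - ω ^ 2) * h 1 x
      - (6 / J₀ * U x ^ 2 + 12 / J₀ * V x ^ 2 - 12 / J₀ * (U x * V x)) * h 1 x
      - 6 / J₀ * U x ^ 2 * h 3 x,
    fun x => -weakDeriv (weakDeriv (h 2)) x + (4 - 9 * ω ^ 2) * h 2 x
      - (18 / J₀ * V x ^ 2 + 12 / J₀ * U x ^ 2) * h 2 x
      - (24 / J₀ * (U x * V x) + 6 / J₀ * U x ^ 2) * h 0 x,
    fun x => -weakDeriv (weakDeriv (h 3)) x + (4 - 9 * ω ^ 2) * h 3 x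
      - (6 / J₀ * V x ^ 2 + 12 / J₀ * U x ^ 2) * h 3 x
      - 6 / J₀ * U x ^ 2 * h 1 x]

/-- The vector `(-U'' + (4-ω²)U, 0, -V'' + (4-9ω²)V, 0)`. -/
def normalVec (ω : ℝ) (U V : ℝ → ℝ) : Fin 4 → ℝ → ℝ :=
  ![fun x => -deriv (deriv U) x + (4 - ω ^ 2) * U x, fun _ => 0,
    fun x => -deriv (deriv V) x + (4 - 9 * ω ^ 2) * V x, fun _ => 0]

end

end Oscillon

/-! `J` is homogeneous of degree 4 and `I` of degree 2, so with `M = sSup (values ω)` the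
constrained problem becomes the unconstrained inequality `J ≤ M * I ^ 2` (`J_le_sSup_mul`).
Existence and the variational conditions both come from this form, and no constraint has to be
followed along a variation.

Existence is concentration compactness in its simplest case. Moduli do not raise `I` or lower `J`,
so nonnegative real pairs suffice (`exists_nonneg_pair`). A nearly maximizing pair cannot be
uniformly small; after a translation it stays away from zero at the origin, so a weak and pointwise
limit is nonzero, with energy `θ ∈ (0, 1]`. Both functionals split asymptotically into the limit and
the remainder, whence `M ≤ M * (θ ^ 2 + (1 - θ) ^ 2)` and `θ = 1` (`exists_maximizer`). Reflecting
one half of the line makes the maximizer even (`exists_even_maximizer`).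

At a maximizer, `M * I ^ 2 - J` along `(U + t(p + iq), V + t(r + is))` is a nonnegative quartic
polynomial in `t` that vanishes at `t = 0`. Its linear coefficient is therefore zero, which is the
weak Euler–Lagrange system, and a bootstrap makes it classical. Its quadratic coefficient is
nonnegative: `Q ≤ M * (4 * B ^ 2 + 2 * E)` (`variation_conditions`). By the first-order condition
`B` equals `⟨h, n⟩`, so on the orthogonal complement of `n` this reads `E - Q / J₀ ≥ 0`, and the
left side is `⟨ℒh, h⟩` (`inner4_linOp`). -/

namespace Oscillon

open Filter Topology Set

/-! ### Primitives of locally integrable functions -/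

section Primitive

theorem absolutelyContinuousOnInterval_of_dist_le {X Y : Type*} [PseudoMetricSpace X]
    [PseudoMetricSpace Y] {f : ℝ → X} {N : ℝ → Y} {a b : ℝ}
    (hN : AbsolutelyContinuousOnInterval N a b)
    (h : ∀ x y, dist (f x) (f y) ≤ dist (N x) (N y)) :
    AbsolutelyContinuousOnInterval f a b := by
  unfold AbsolutelyContinuousOnInterval at *
  refine squeeze_zero (fun t => Finset.sum_nonneg fun i _ => dist_nonneg)
    (fun t => Finset.sum_le_sum fun i _ => h _ _) hN

variable {E : Type*} [NormedAddCommGroup E] {f g : ℝ → E}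

theorem intervalIntegrable_of_locallyIntegrable (hg : LocallyIntegrable g) (x y : ℝ) :
    IntervalIntegrable g volume x y :=
  intervalIntegrable_iff.mpr
    ((hg.integrableOn_isCompact isCompact_uIcc).mono_set uIoc_subset_uIcc)

variable [NormedSpace ℝ E]

/-- A function whose increments are the integrals of `g` is absolutely continuous. -/
theorem absolutelyContinuousOnInterval_of_sub_eq (hg : LocallyIntegrable g)
    (h : ∀ x y, f y - f x = ∫ t in x..y, g t) (a b : ℝ) :
    AbsolutelyContinuousOnInterval f a b := by
  have hn : LocallyIntegrable (fun x => ‖g x‖) := fun x => (hg x).norm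
  have hi := intervalIntegrable_of_locallyIntegrable hn
  refine absolutelyContinuousOnInterval_of_dist_le
    (N := fun x => ∫ t in a..x, ‖g t‖)
    ((hi a b).absolutelyContinuousOnInterval_intervalIntegral (by simp)) fun x y => ?_
  rw [dist_comm, dist_eq_norm, h, dist_comm, Real.dist_eq,
    intervalIntegral.integral_interval_sub_left (hi _ _) (hi _ _)]
  exact intervalIntegral.norm_integral_le_abs_integral_norm

theorem continuous_of_sub_eq (hg : LocallyIntegrable g)
    (h : ∀ x y, f y - f x = ∫ t in x..y, g t) : Continuous f := by
  refine continuous_iff_continuousAt.mpr fun x => ?_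
  refine (absolutelyContinuousOnInterval_of_sub_eq hg h
    (x - 1) (x + 1)).continuousOn.continuousAt ?_
  rw [uIcc_of_le (by linarith)]
  exact Icc_mem_nhds (by linarith) (by linarith)

variable [CompleteSpace E]

theorem ae_hasDerivAt_of_sub_eq (hg : LocallyIntegrable g)
    (h : ∀ x y, f y - f x = ∫ t in x..y, g t) : ∀ᵐ x, HasDerivAt f (g x) x := by
  filter_upwards [_root_.LocallyIntegrable.ae_hasDerivAt_integral hg] with x hx
  have : f = fun y => f 0 + ∫ t in (0 : ℝ)..y, g t := by
    ext y; rw [← h]; abel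
  rw [this]
  exact (hx 0).const_add _

/-- The fundamental theorem of calculus for absolutely continuous functions whose derivative is
known almost everywhere. -/
theorem sub_eq_integral_of_ae_hasDerivAt {a b : ℝ} (hf : AbsolutelyContinuousOnInterval f a b)
    (hg : LocallyIntegrable g) (h : ∀ᵐ x, HasDerivAt f (g x) x) :
    f b - f a = ∫ t in a..b, g t := by
  have hi := intervalIntegrable_of_locallyIntegrable hg
  have h0 : ∀ x y, (∫ t in a..y, g t) - (∫ t in a..x, g t) = ∫ t in x..y, g t := fun x y =>
    intervalIntegral.integral_interval_sub_left (hi _ _) (hi _ _)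
  have hac := hf.sub (absolutelyContinuousOnInterval_of_sub_eq hg h0 a b)
  obtain ⟨C, hC⟩ := hac.const_of_ae_hasDerivAt_zero (by
    filter_upwards [h, _root_.LocallyIntegrable.ae_hasDerivAt_integral hg] with x hx hx' _
    simpa using hx.sub (hx' a))
  have h1 := hC a (by simp)
  have h2 := hC b (by simp)
  simp only [Pi.sub_apply, intervalIntegral.integral_same, sub_zero] at h1 h2
  rw [h1, ← h2]; abel

theorem hasWeakDeriv_of_sub_eq (hg : LocallyIntegrable g)
    (h : ∀ x y, f y - f x = ∫ t in x..y, g t) : HasWeakDeriv f g := by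
  have hcf := continuous_of_sub_eq hg h
  refine ⟨hcf.locallyIntegrable, hg, fun φ hφ hc => ?_⟩
  have hd : Continuous (deriv φ) := hφ.continuous_deriv (by simp)
  have i1 : Integrable (fun x => deriv φ x • f x) :=
    (hd.smul hcf).integrable_of_hasCompactSupport hc.deriv.smul_right
  have i2 : Integrable (fun x => φ x • g x) :=
    hg.integrable_smul_left_of_hasCompactSupport hφ.continuous hc
  rw [eq_neg_iff_add_eq_zero, ← integral_add i1 i2]
  obtain ⟨R, hR⟩ := hc.isCompact.isBounded.subset_closedBall 0
  -- Outside the support the boundary terms vanish, so the integral of the derivative of `φ • f`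
  -- over all large symmetric intervals is zero.
  have hz : ∀ x, R < |x| → φ x = 0 := fun x hx => by
    by_contra h0
    have := hR (subset_tsupport φ h0)
    simp at this; linarith
  have hF : ∀ a b : ℝ, φ b • f b - φ a • f a = ∫ t in a..b, (deriv φ t • f t + φ t • g t) := by
    intro a b
    refine sub_eq_integral_of_ae_hasDerivAt (f := fun x => φ x • f x)
      (AbsolutelyContinuousOnInterval.smul ?_ (absolutelyContinuousOnInterval_of_sub_eq hg h a b))
      (i1.add i2).locallyIntegrable ?_
    · exact ((hφ.of_le (by simp)).contDiffOn).absolutelyContinuousOnInterval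
    · filter_upwards [ae_hasDerivAt_of_sub_eq hg h] with x hx
      have := ((hφ.differentiable (by simp)) x).hasDerivAt.smul hx
      rwa [add_comm] at this
  have hlim : Tendsto (fun n : ℕ => ∫ t in (-(n : ℝ))..n, (deriv φ t • f t + φ t • g t)) atTop
      (𝓝 (∫ t, (deriv φ t • f t + φ t • g t))) :=
    intervalIntegral_tendsto_integral (i1.add i2)
      (tendsto_neg_atTop_atBot.comp tendsto_natCast_atTop_atTop) tendsto_natCast_atTop_atTop
  refine tendsto_nhds_unique hlim (tendsto_const_nhds.congr' ?_)
  filter_upwards [eventually_gt_atTop ⌈R⌉₊] with n hn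
  have hn' : R < n := Nat.lt_of_ceil_lt hn
  rw [← hF, hz n (by rwa [Nat.abs_cast]), hz (-n) (by rwa [abs_neg, Nat.abs_cast])]
  simp

end Primitive

/-! ### Continuous representatives of `H¹` functions -/

/-- `f` is the continuous representative of a function of `H¹(ℝ)`, with weak derivative `g`. -/
structure IsH1 {E : Type*} [NormedAddCommGroup E] [NormedSpace ℝ E] (f g : ℝ → E) : Prop where
  memLp : MemLp f 2
  memLp_deriv : MemLp g 2
  sub_eq : ∀ x y, f y - f x = ∫ t in x..y, g t

namespace IsH1

variable {E : Type*} [NormedAddCommGroup E] [NormedSpace ℝ E] {f g f₁ g₁ : ℝ → E}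

theorem locallyIntegrable_deriv (h : IsH1 f g) : LocallyIntegrable g :=
  h.memLp_deriv.locallyIntegrable (by norm_num)

theorem intervalIntegrable (h : IsH1 f g) (x y : ℝ) : IntervalIntegrable g volume x y :=
  intervalIntegrable_of_locallyIntegrable h.locallyIntegrable_deriv x y

theorem absolutelyContinuousOnInterval (h : IsH1 f g) (a b : ℝ) :
    AbsolutelyContinuousOnInterval f a b :=
  absolutelyContinuousOnInterval_of_sub_eq h.locallyIntegrable_deriv h.sub_eq a b

theorem continuous (h : IsH1 f g) : Continuous f :=
  continuous_of_sub_eq h.locallyIntegrable_deriv h.sub_eq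

theorem congr_deriv (h : IsH1 f g) (hg : g =ᵐ[volume] g₁) : IsH1 f g₁ where
  memLp := h.memLp
  memLp_deriv := (memLp_congr_ae hg).mp h.memLp_deriv
  sub_eq x y := by
    rw [h.sub_eq]
    exact intervalIntegral.integral_congr_ae (hg.mono fun x hx _ => hx)

theorem add (h : IsH1 f g) (h₁ : IsH1 f₁ g₁) :
    IsH1 (fun x => f x + f₁ x) (fun x => g x + g₁ x) where
  memLp := h.memLp.add h₁.memLp
  memLp_deriv := h.memLp_deriv.add h₁.memLp_deriv
  sub_eq x y := by
    rw [intervalIntegral.integral_add (h.intervalIntegrable _ _) (h₁.intervalIntegrable _ _),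
      ← h.sub_eq, ← h₁.sub_eq]
    abel

theorem const_mul {f g : ℝ → ℝ} (h : IsH1 f g) (c : ℝ) :
    IsH1 (fun x => c * f x) (fun x => c * g x) where
  memLp := h.memLp.const_mul c
  memLp_deriv := h.memLp_deriv.const_mul c
  sub_eq x y := by
    rw [intervalIntegral.integral_const_mul, ← h.sub_eq]; ring

theorem const_smul (h : IsH1 f g) (c : ℝ) :
    IsH1 (fun x => c • f x) (fun x => c • g x) where
  memLp := h.memLp.const_smul c
  memLp_deriv := h.memLp_deriv.const_smul c
  sub_eq x y := by
    rw [intervalIntegral.integral_smul, ← h.sub_eq, smul_sub]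

theorem sub {f g f₁ g₁ : ℝ → ℝ} (h : IsH1 f g) (h₁ : IsH1 f₁ g₁) :
    IsH1 (fun x => f x - f₁ x) (fun x => g x - g₁ x) := by
  simpa [sub_eq_add_neg] using h.add (h₁.const_mul (-1))

theorem zero : IsH1 (fun _ => (0 : E)) (fun _ => 0) :=
  ⟨MemLp.zero', MemLp.zero', by simp⟩

theorem comp_add_right (h : IsH1 f g) (c : ℝ) :
    IsH1 (fun x => f (x + c)) (fun x => g (x + c)) where
  memLp := h.memLp.comp_measurePreserving (measurePreserving_add_right volume c)
  memLp_deriv := h.memLp_deriv.comp_measurePreserving (measurePreserving_add_right volume c)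
  sub_eq x y := by
    rw [h.sub_eq, intervalIntegral.integral_comp_add_right]

theorem comp_neg (h : IsH1 f g) : IsH1 (fun x => f (-x)) (fun x => -g (-x)) where
  memLp := h.memLp.comp_measurePreserving (Measure.measurePreserving_neg volume)
  memLp_deriv := (h.memLp_deriv.comp_measurePreserving (Measure.measurePreserving_neg volume)).neg
  sub_eq x y := by
    rw [h.sub_eq, intervalIntegral.integral_neg, intervalIntegral.integral_comp_neg,
      intervalIntegral.integral_symm]

theorem ofReal {p p' : ℝ → ℝ} (hp : IsH1 p p') :
    IsH1 (fun x => (p x : ℂ)) (fun x => (p' x : ℂ)) where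
  memLp := hp.memLp.ofReal
  memLp_deriv := hp.memLp_deriv.ofReal
  sub_eq x y := by
    rw [intervalIntegral.integral_ofReal, ← hp.sub_eq]
    push_cast; ring

theorem mul_I {p p' : ℝ → ℂ} (hp : IsH1 p p') :
    IsH1 (fun x => p x * Complex.I) (fun x => p' x * Complex.I) where
  memLp := by simpa only [mul_comm] using hp.memLp.const_mul Complex.I
  memLp_deriv := by simpa only [mul_comm] using hp.memLp_deriv.const_mul Complex.I
  sub_eq x y := by
    rw [intervalIntegral.integral_mul_const, ← hp.sub_eq]; ring

theorem complex {p p' q q' : ℝ → ℝ} (hp : IsH1 p p') (hq : IsH1 q q') :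
    IsH1 (fun x => (p x + q x * Complex.I : ℂ)) (fun x => (p' x + q' x * Complex.I : ℂ)) :=
  hp.ofReal.add hq.ofReal.mul_I

variable [CompleteSpace E]

theorem ae_hasDerivAt (h : IsH1 f g) : ∀ᵐ x, HasDerivAt f (g x) x :=
  ae_hasDerivAt_of_sub_eq h.locallyIntegrable_deriv h.sub_eq

theorem hasWeakDeriv (h : IsH1 f g) : HasWeakDeriv f g :=
  hasWeakDeriv_of_sub_eq h.locallyIntegrable_deriv h.sub_eq

end IsH1

/-! ### Weak derivatives: uniqueness and representatives -/

section WeakDeriv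

variable {E : Type*} [NormedAddCommGroup E] [NormedSpace ℝ E]

theorem HasWeakDeriv.congr_left {f f₁ g : ℝ → E} (h : HasWeakDeriv f g)
    (hf : f =ᵐ[volume] f₁) : HasWeakDeriv f₁ g := by
  refine ⟨?_, h.2.1, fun φ hφ hφc => ?_⟩
  · exact fun x => (h.1 x).congr hf
  · rw [← h.2.2 φ hφ hφc]
    exact integral_congr_ae (hf.mono fun x hx => by simp only [hx])

variable [CompleteSpace E]

/-- A locally integrable function with vanishing weak derivative is constant. -/
theorem ae_eq_const_of_integral_deriv_smul_eq_zero {k : ℝ → E} (hk : LocallyIntegrable k)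
    (h : ∀ φ : ℝ → ℝ, ContDiff ℝ (⊤ : ℕ∞) φ → HasCompactSupport φ →
      ∫ x, deriv φ x • k x = 0) : ∃ c, ∀ᵐ x, k x = c := by
  let η : ContDiffBump (0 : ℝ) := ⟨1, 2, by norm_num, by norm_num⟩
  set e : ℝ → ℝ := η.normed volume with he
  have e_smooth : ContDiff ℝ (⊤ : ℕ∞) e := η.contDiff_normed
  have e_supp : HasCompactSupport e := η.hasCompactSupport_normed
  have e_int : ∫ x, e x = 1 := η.integral_normed
  have int_smul : ∀ φ : ℝ → ℝ, Continuous φ → HasCompactSupport φ →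
      Integrable (fun x => φ x • k x) := fun φ h1 h2 =>
    hk.integrable_smul_left_of_hasCompactSupport h1 h2
  refine ⟨∫ x, e x • k x, ?_⟩
  set c := ∫ x, e x • k x with hc
  suffices ∀ᵐ x, (fun x => k x - c) x = 0 from this.mono fun x hx => sub_eq_zero.mp hx
  refine ae_eq_zero_of_integral_contDiff_smul_eq_zero
    (hk.sub continuous_const.locallyIntegrable) fun φ hφ hφc => ?_
  set m := ∫ x, φ x with hm
  have hφi : Integrable φ := hφ.continuous.integrable_of_hasCompactSupport hφc
  have hei : Integrable e := e_smooth.continuous.integrable_of_hasCompactSupport e_supp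
  -- Subtracting `m * e` gives mean zero, so the primitive `ψ` of `θ` is again compactly supported
  -- and is an admissible test function with derivative `θ`.
  set θ : ℝ → ℝ := fun x => φ x - m * e x with hθ
  have θ_smooth : ContDiff ℝ (⊤ : ℕ∞) θ := hφ.sub (contDiff_const.mul e_smooth)
  have θ_supp : HasCompactSupport θ := by
    have : θ = φ + (fun _ => -m) * e := by
      ext x; simp [hθ, sub_eq_add_neg]
    exact this ▸ hφc.add (e_supp.mul_left (f := fun _ => -m))
  have θ_int : ∫ x, θ x = 0 := by
    rw [hθ, integral_sub hφi (hei.const_mul m), integral_const_mul, e_int, mul_one, sub_self]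
  have θ_i : Integrable θ := θ_smooth.continuous.integrable_of_hasCompactSupport θ_supp
  obtain ⟨R, hR⟩ := θ_supp.isCompact.isBounded.subset_closedBall 0
  have hz : ∀ x, R < |x| → θ x = 0 := fun x hx => by
    by_contra h0
    have := hR (subset_tsupport θ h0)
    simp at this; linarith
  set S : ℝ := |R| + 1 with hS
  have hRS : R < S := by linarith [le_abs_self R]
  have hS0 : 0 < S := by positivity
  set ψ : ℝ → ℝ := fun x => ∫ t in (-S)..x, θ t with hψ
  have hd : ∀ x, HasDerivAt ψ (θ x) x := fun x =>
    θ_smooth.continuous.integral_hasStrictDerivAt _ x |>.hasDerivAt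
  have ψd : deriv ψ = θ := funext fun x => (hd x).deriv
  have ψ_smooth : ContDiff ℝ (⊤ : ℕ∞) ψ :=
    contDiff_infty_iff_deriv.mpr ⟨fun x => (hd x).differentiableAt, ψd ▸ θ_smooth⟩
  have ψ_supp : HasCompactSupport ψ := by
    refine HasCompactSupport.intro (isCompact_Icc (a := -S) (b := S)) fun x hx => ?_
    rcases lt_or_ge x (-S) with h1 | h1
    · refine intervalIntegral.integral_zero_ae (ae_of_all _ fun t ht => hz t ?_)
      rw [uIoc_comm, uIoc_of_le h1.le] at ht
      rw [abs_of_neg (by linarith [ht.2])]; linarith [ht.2]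
    · have h2 : S < x := by
        by_contra h3; exact hx ⟨h1, not_lt.mp h3⟩
      simp only [hψ]
      rw [intervalIntegral.integral_of_le h1, ← θ_int]
      refine setIntegral_eq_integral_of_forall_compl_eq_zero fun t ht => hz t ?_
      simp only [mem_Ioc, not_and_or, not_lt, not_le] at ht
      rcases ht with ht | ht
      · rw [abs_of_neg (by linarith)]; linarith
      · rw [abs_of_pos (by linarith)]; linarith
  have key := h ψ ψ_smooth ψ_supp
  rw [ψd] at key
  have e1 : (fun x => θ x • k x) = fun x => φ x • k x - m • (e x • k x) := by
    ext x; simp [hθ, sub_smul, mul_smul]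
  have ie := int_smul e e_smooth.continuous e_supp
  have iφ := int_smul φ hφ.continuous hφc
  rw [e1, integral_sub iφ (ie.fun_smul m), integral_smul] at key
  have e2 : (fun x => φ x • (k x - c)) = fun x => φ x • k x - φ x • c := by
    ext x; simp [smul_sub]
  rw [e2, integral_sub iφ (hφi.smul_const c), integral_smul_const]
  exact key

theorem HasWeakDeriv.ae_unique {f f₁ g g₁ : ℝ → E} (h : HasWeakDeriv f g)
    (h₁ : HasWeakDeriv f₁ g₁) (hf : f =ᵐ[volume] f₁) : g =ᵐ[volume] g₁ := by
  suffices ∀ᵐ x, (fun x => g x - g₁ x) x = 0 from this.mono fun x hx => sub_eq_zero.mp hx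
  refine ae_eq_zero_of_integral_contDiff_smul_eq_zero (h.2.1.sub h₁.2.1) fun φ hφ hφc => ?_
  have i := h.2.1.integrable_smul_left_of_hasCompactSupport hφ.continuous hφc
  have i₁ := h₁.2.1.integrable_smul_left_of_hasCompactSupport hφ.continuous hφc
  simp_rw [smul_sub]
  rw [integral_sub i i₁, sub_eq_zero, ← neg_inj, ← h.2.2 φ hφ hφc, ← h₁.2.2 φ hφ hφc]
  exact integral_congr_ae (hf.mono fun x hx => by simp only [hx])

/-- The function and the primitive of its weak derivative have the same weak derivative, so they
differ by a constant almost everywhere. -/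
theorem HasWeakDeriv.exists_isH1 {f g : ℝ → E} (h : HasWeakDeriv f g) (hf : MemLp f 2)
    (hg : MemLp g 2) : ∃ F, f =ᵐ[volume] F ∧ IsH1 F g := by
  have hi := intervalIntegrable_of_locallyIntegrable h.2.1
  have h0 : ∀ x y, (∫ t in (0:ℝ)..y, g t) - (∫ t in (0:ℝ)..x, g t) = ∫ t in x..y, g t :=
    fun x y => intervalIntegral.integral_interval_sub_left (hi _ _) (hi _ _)
  have h1 := hasWeakDeriv_of_sub_eq h.2.1 h0
  obtain ⟨c, hc⟩ := ae_eq_const_of_integral_deriv_smul_eq_zero (h.1.sub h1.1)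
    fun φ hφ hφc => by
      have hd := (hφ.continuous_deriv (by simp))
      have i := h.1.integrable_smul_left_of_hasCompactSupport hd hφc.deriv
      have i₁ := h1.1.integrable_smul_left_of_hasCompactSupport hd hφc.deriv
      simp_rw [Pi.sub_apply, smul_sub]
      rw [integral_sub i i₁, h.2.2 φ hφ hφc, h1.2.2 φ hφ hφc, sub_self]
  have hF : f =ᵐ[volume] fun x => c + ∫ t in (0:ℝ)..x, g t := by
    filter_upwards [hc] with x hx
    rw [← hx]; simp
  exact ⟨_, hF, (memLp_congr_ae hF).mp hf, hg, fun x y => by rw [add_sub_add_left_eq_sub, h0]⟩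

theorem MemH1.hasWeakDeriv_weakDeriv {f : ℝ → E} (h : MemH1 f) :
    HasWeakDeriv f (weakDeriv f) ∧ MemLp (weakDeriv f) 2 := by
  obtain ⟨_, g, hg, hfg⟩ := h
  have hex : ∃ g, HasWeakDeriv f g := ⟨g, hfg⟩
  have hw : HasWeakDeriv f (weakDeriv f) := by
    rw [weakDeriv, dif_pos hex]; exact hex.choose_spec
  exact ⟨hw, (memLp_congr_ae (hfg.ae_unique hw (ae_eq_refl f))).mp hg⟩

theorem MemH1.exists_isH1 {f : ℝ → E} (h : MemH1 f) :
    ∃ F, f =ᵐ[volume] F ∧ IsH1 F (weakDeriv f) :=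
  h.hasWeakDeriv_weakDeriv.1.exists_isH1 h.1 h.hasWeakDeriv_weakDeriv.2

theorem IsH1.memH1_of_ae_eq {f F G : ℝ → E} (h : IsH1 F G) (hf : f =ᵐ[volume] F) : MemH1 f :=
  ⟨(memLp_congr_ae hf).mpr h.memLp, G, h.memLp_deriv, h.hasWeakDeriv.congr_left hf.symm⟩

theorem IsH1.weakDeriv_ae_eq {f F G : ℝ → E} (h : IsH1 F G) (hf : f =ᵐ[volume] F) :
    weakDeriv f =ᵐ[volume] G :=
  (h.memH1_of_ae_eq hf).hasWeakDeriv_weakDeriv.1.ae_unique h.hasWeakDeriv hf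

end WeakDeriv

/-! ### Calculus in `H¹`: moduli, sup bound, integration by parts, reflection -/

namespace IsH1

/-- The norm of an `H¹` function is in `H¹`, with a smaller derivative. -/
theorem norm {E : Type*} [NormedAddCommGroup E] [NormedSpace ℝ E] [CompleteSpace E]
    {f g : ℝ → E} (h : IsH1 f g) :
    ∃ g₁ : ℝ → ℝ, IsH1 (fun x => ‖f x‖) g₁ ∧ ∀ᵐ x, |g₁ x| ≤ ‖g x‖ := by
  set F : ℝ → ℝ := fun x => ‖f x‖ with hF
  have hac : ∀ a b, AbsolutelyContinuousOnInterval F a b := fun a b =>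
    absolutelyContinuousOnInterval_of_dist_le (h.absolutelyContinuousOnInterval a b)
      fun x y => (dist_norm_norm_le _ _).trans_eq (dist_eq_norm _ _).symm
  have hle : ∀ᵐ x, |deriv F x| ≤ ‖g x‖ := by
    filter_upwards [h.ae_hasDerivAt] with x hx
    by_cases hd : DifferentiableAt ℝ F x
    · have t1 := (hasDerivAt_iff_tendsto_slope.mp hd.hasDerivAt).norm
      have t2 := (hasDerivAt_iff_tendsto_slope.mp hx).norm
      refine le_of_tendsto_of_tendsto' t1 t2 fun y => ?_
      simp only [slope, norm_smul, vsub_eq_sub]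
      gcongr
      exact abs_norm_sub_norm_le _ _
    -- Where the norm is not differentiable `deriv` is `0` by convention, so the bound is trivial
    -- there.
    · simp [deriv_zero_of_not_differentiableAt hd]
  refine ⟨deriv F, ⟨h.memLp.norm, ?_, fun x y => ((hac x y).integral_deriv_eq_sub).symm⟩, hle⟩
  exact h.memLp_deriv.mono (measurable_deriv F).aestronglyMeasurable hle

variable {f g f₁ g₁ : ℝ → ℝ}

theorem integrable_sq (h : IsH1 f g) : Integrable fun x => f x ^ 2 := h.memLp.integrable_sq

theorem integrable_deriv_sq (h : IsH1 f g) : Integrable fun x => g x ^ 2 :=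
  h.memLp_deriv.integrable_sq

/-- On `[x, x + 1]` the function varies by at most `m = ∫ |g|`, so `f x ^ 2 ≤ 2 * f y ^ 2 + 2 * m ^
2`; averaging over `y` and using `m ^ 2 ≤ ∫ g ^ 2` on an interval of length one gives the bound. -/
theorem sq_le (h : IsH1 f g) (x : ℝ) : f x ^ 2 ≤ 2 * ((∫ y, f y ^ 2) + ∫ y, g y ^ 2) := by
  have hg := h.intervalIntegrable x (x + 1)
  have hg' := hg.abs
  have hf2 : IntervalIntegrable (fun y => f y ^ 2) volume x (x + 1) :=
    h.integrable_sq.intervalIntegrable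
  have hg2 : IntervalIntegrable (fun y => g y ^ 2) volume x (x + 1) :=
    h.integrable_deriv_sq.intervalIntegrable
  set m := ∫ t in x..(x + 1), |g t| with hm
  have hm2 : m ^ 2 ≤ ∫ t in x..(x + 1), g t ^ 2 := by
    have h0 : 0 ≤ ∫ t in x..(x + 1), (|g t| - m) ^ 2 :=
      intervalIntegral.integral_nonneg (by linarith) fun _ _ => sq_nonneg _
    have e : ∀ t, (|g t| - m) ^ 2 = g t ^ 2 - 2 * m * |g t| + m ^ 2 := fun t => by
      rw [sub_sq, sq_abs]; ring
    simp_rw [e] at h0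
    rw [intervalIntegral.integral_add (hg2.sub (hg'.const_mul _)) (by simp),
      intervalIntegral.integral_sub hg2 (hg'.const_mul _),
      intervalIntegral.integral_const_mul, ← hm] at h0
    simp at h0
    nlinarith
  have hle : ∀ s : ℝ → ℝ, (∀ y, 0 ≤ s y) → Integrable s → ∫ t in x..(x + 1), s t ≤ ∫ t, s t :=
    fun s hs hi => by
      rw [intervalIntegral.integral_of_le (by linarith)]
      exact setIntegral_le_integral hi (ae_of_all _ hs)
  have hpt : ∀ y ∈ Icc x (x + 1), f x ^ 2 ≤ 2 * f y ^ 2 + 2 * m ^ 2 := fun y hy => by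
    have h1 : |f y - f x| ≤ m := by
      rw [h.sub_eq]
      refine (intervalIntegral.abs_integral_le_integral_abs hy.1).trans ?_
      exact intervalIntegral.integral_mono_interval le_rfl hy.1 hy.2
        (ae_of_all _ fun _ => abs_nonneg _) hg'
    have h2 := sq_le_sq' (by linarith [abs_nonneg (f y - f x)]) h1
    rw [sq_abs] at h2
    nlinarith [sq_nonneg (f x - f y + f y - (f y - f x) ), sq_nonneg (2 * f y - f x)]
  have h3 : ∫ _ in x..(x + 1), f x ^ 2 ≤ ∫ y in x..(x + 1), (2 * f y ^ 2 + 2 * m ^ 2) :=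
    intervalIntegral.integral_mono_on (by linarith) (by simp)
      ((hf2.const_mul 2).add (by simp)) hpt
  rw [intervalIntegral.integral_add (hf2.const_mul 2) (by simp),
    intervalIntegral.integral_const_mul] at h3
  simp at h3
  have h4 := hle (fun y => f y ^ 2) (fun y => sq_nonneg _) h.integrable_sq
  have h5 := hle (fun y => g y ^ 2) (fun y => sq_nonneg _) h.integrable_deriv_sq
  linarith

/-- Integration by parts for `H¹` functions. -/
theorem integral_deriv_mul (h : IsH1 f g) (h₁ : IsH1 f₁ g₁) :
    ∫ x, g x * f₁ x = - ∫ x, f x * g₁ x := by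
  have i1 : Integrable fun x => g x * f₁ x := h.memLp_deriv.integrable_mul h₁.memLp
  have i2 : Integrable fun x => f x * g₁ x := h.memLp.integrable_mul h₁.memLp_deriv
  have i3 : Integrable fun x => f x * f₁ x := h.memLp.integrable_mul h₁.memLp
  rw [eq_neg_iff_add_eq_zero, ← integral_add i1 i2]
  have hF : ∀ a b : ℝ, f b * f₁ b - f a * f₁ a = ∫ t in a..b, (g t * f₁ t + f t * g₁ t) := by
    intro a b
    refine sub_eq_integral_of_ae_hasDerivAt (f := fun x => f x * f₁ x)
      ((h.absolutelyContinuousOnInterval a b).mul (h₁.absolutelyContinuousOnInterval a b))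
      (i1.add i2).locallyIntegrable ?_
    filter_upwards [h.ae_hasDerivAt, h₁.ae_hasDerivAt] with x hx hx₁
    exact hx.mul hx₁
  have hlim : Tendsto (fun R : ℝ => ∫ t in (-R)..R, (g t * f₁ t + f t * g₁ t)) atTop
      (𝓝 (∫ t, (g t * f₁ t + f t * g₁ t))) :=
    intervalIntegral_tendsto_integral (i1.add i2) tendsto_neg_atTop_atBot tendsto_id
  simp_rw [← hF] at hlim
  -- The boundary term, as a function of `R`, is integrable and has a limit at infinity; the limit
  -- must be zero.
  refine IntegrableAtFilter.eq_zero_of_tendsto (μ := volume)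
    ((i3.sub i3.comp_neg).integrableAtFilter atTop) (fun s hs => ?_) hlim
  obtain ⟨b, hb⟩ := mem_atTop_sets.mp hs
  exact top_unique (Real.volume_Ici (a := b) ▸ measure_mono hb)

/-- The even extension of the restriction of an `H¹` function to the half-line. -/
theorem comp_abs (h : IsH1 f g) :
    IsH1 (fun x => f |x|) (fun x => (if 0 ≤ x then 1 else -1) * g |x|) := by
  have hL : ∀ k : ℝ → ℝ, MemLp k 2 → MemLp (fun x => k |x|) 2 := fun k hk => by
    have h1 := hk.indicator (measurableSet_Ici (a := (0 : ℝ)))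
    have h2 := (hk.comp_measurePreserving (Measure.measurePreserving_neg volume)).indicator
      (measurableSet_Iio (a := (0 : ℝ)))
    refine (h1.add h2).ae_eq (ae_of_all _ fun x => ?_)
    rcases lt_or_ge x 0 with hx | hx
    · simp [hx, abs_of_neg hx]
    · simp [hx, abs_of_nonneg hx]
  have hg : MemLp (fun x => (if 0 ≤ x then 1 else -1) * g |x|) 2 := by
    refine (hL g h.memLp_deriv).mono ?_ (ae_of_all _ fun x => ?_)
    · refine AEStronglyMeasurable.mul ?_ (hL g h.memLp_deriv).1
      exact (Measurable.ite measurableSet_Ici measurable_const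
        measurable_const).aestronglyMeasurable
    · split_ifs <;> simp
  refine ⟨hL f h.memLp, hg, ?_⟩
  have key : ∀ y, f |y| - f |0| = ∫ t in (0:ℝ)..y, (if 0 ≤ t then 1 else -1) * g |t| := fun y => by
    rcases le_total 0 y with hy | hy
    · rw [abs_of_nonneg hy, abs_zero, h.sub_eq]
      refine intervalIntegral.integral_congr fun t ht => ?_
      rw [uIcc_of_le hy] at ht
      simp [ht.1, abs_of_nonneg ht.1]
    · rw [abs_of_nonpos hy, abs_zero, h.sub_eq]
      have : ∫ t in (0:ℝ)..y, (if 0 ≤ t then 1 else -1) * g |t| = ∫ t in (0:ℝ)..y, -g (-t) := by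
        refine intervalIntegral.integral_congr_ae ?_
        -- The point `0` is discarded because the sign there is `+1` by convention.
        filter_upwards [compl_mem_ae_iff.mpr (measure_singleton (0:ℝ))] with t h0 ht
        rw [uIoc_comm, uIoc_of_le hy] at ht
        have : t < 0 := lt_of_le_of_ne ht.2 h0
        simp [this, abs_of_neg this]
      rw [this, intervalIntegral.integral_neg, intervalIntegral.integral_comp_neg,
        intervalIntegral.integral_symm]
      simp
  intro x y
  have hi := intervalIntegrable_of_locallyIntegrable (hg.locallyIntegrable (by norm_num))
  rw [← intervalIntegral.integral_interval_sub_left (hi 0 y) (hi 0 x), ← key, ← key]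
  ring

end IsH1

/-! ### Weak compactness -/

section WeakCompactness

/-- Bounded sequences in `L²(ℝ)` have weakly convergent subsequences. -/
theorem exists_weakly_convergent_subseq {g : ℕ → ℝ → ℝ} (hg : ∀ n, MemLp (g n) 2) {C : ℝ}
    (hC : ∀ n, ∫ x, g n x ^ 2 ≤ C) :
    ∃ φ : ℕ → ℕ, StrictMono φ ∧ ∃ G : ℝ → ℝ, MemLp G 2 ∧ ∀ a : ℝ → ℝ, MemLp a 2 →
      Tendsto (fun n => ∫ x, a x * g (φ n) x) atTop (𝓝 (∫ x, a x * G x)) := by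
  have : Fact ((1 : ENNReal) ≤ 2) := ⟨by norm_num⟩
  have : Fact ((2 : ENNReal) ≠ ⊤) := ⟨by norm_num⟩
  let H := Lp ℝ 2 (volume : Measure ℝ)
  let x : ℕ → H := fun n => (hg n).toLp
  have inner_eq : ∀ (a b : ℝ → ℝ) (ha : MemLp a 2) (hb : MemLp b 2),
      inner ℝ (ha.toLp : H) (hb.toLp : H) = ∫ t, b t * a t := fun a b ha hb => by
    rw [L2.inner_def]
    refine integral_congr_ae ?_
    filter_upwards [ha.coeFn_toLp, hb.coeFn_toLp] with t h1 h2
    rw [h1, h2]; simp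
  have hx : ∀ n, ‖x n‖ ≤ √C := fun n => by
    refine Real.le_sqrt_of_sq_le ?_
    rw [← real_inner_self_eq_norm_sq, inner_eq]
    simpa [sq] using hC n
  -- Through the Riesz isomorphism, the claim is sequential Banach–Alaoglu in the dual of a
  -- separable space.
  let d : ℕ → WeakDual ℝ H := fun n => StrongDual.toWeakDual (InnerProductSpace.toDual ℝ H (x n))
  have hd : ∀ n, d n ∈ WeakDual.toStrongDual ⁻¹'
      Metric.closedBall (0 : StrongDual ℝ H) (√C) := fun n => by
    simp only [mem_preimage, Metric.mem_closedBall, dist_zero_right]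
    exact ((InnerProductSpace.toDual ℝ H).norm_map (x n)).trans_le (hx n)
  obtain ⟨D, -, φ, hφ, hlim⟩ := WeakDual.isSeqCompact_closedBall ℝ H 0 (√C) hd
  let y : H := (InnerProductSpace.toDual ℝ H).symm (WeakDual.toStrongDual D)
  refine ⟨φ, hφ, y, Lp.memLp y, fun a ha => ?_⟩
  have h1 : Tendsto (fun n => d (φ n) ha.toLp) atTop (𝓝 (D ha.toLp)) :=
    ((WeakDual.eval_continuous (ha.toLp : H)).tendsto D).comp hlim
  have h2 : ∀ n, d (φ n) ha.toLp = ∫ t, a t * g (φ n) t := fun n => inner_eq _ _ (hg _) ha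
  have h3 : D ha.toLp = ∫ t, a t * y t := by
    have : D ha.toLp = inner ℝ y (ha.toLp : H) := by
      simp [y]
    rw [this, L2.inner_def]
    refine integral_congr_ae ?_
    filter_upwards [ha.coeFn_toLp] with t h1
    rw [h1]; simp
  simpa only [h2, h3] using h1

/-- A sequence bounded in `L²` and converging pointwise to zero converges weakly to zero, also
in absolute value. -/
theorem tendsto_integral_abs_mul_of_tendsto_zero {a : ℝ → ℝ} (ha : MemLp a 2) {r : ℕ → ℝ → ℝ}
    (hr : ∀ n, MemLp (r n) 2) {C : ℝ} (hC : ∀ n, ∫ x, r n x ^ 2 ≤ C)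
    (hlim : ∀ x, Tendsto (fun n => r n x) atTop (𝓝 0)) :
    Tendsto (fun n => ∫ x, |a x| * |r n x|) atTop (𝓝 0) := by
  have hi : ∀ n, Integrable fun x => |a x| * |r n x| := fun n =>
    ha.abs.integrable_mul (hr n).abs
  rw [Metric.tendsto_atTop]
  intro η hη
  have hC0 : 0 ≤ C := (integral_nonneg fun _ => sq_nonneg _).trans (hC 0)
  set ε := η / (2 * (C + 1)) with hε
  have hε0 : 0 < ε := by positivity
  have hεC : ε * C < η / 2 := by
    rw [hε, div_mul_eq_mul_div, div_lt_div_iff₀ (by positivity) (by positivity)]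
    nlinarith
  have him : ∀ n, Integrable fun x => max (|a x| * |r n x| - ε * r n x ^ 2) 0 := fun n =>
    ((hi n).sub ((hr n).integrable_sq.const_mul ε)).pos_part
  -- The part of `|a| * |r n|` above `ε * r n ^ 2` is at most `a ^ 2 / (4 * ε)`, so dominated
  -- convergence applies to it; what is left costs at most `ε * C < η / 2`.
  have h0 : Tendsto (fun n => ∫ x, max (|a x| * |r n x| - ε * r n x ^ 2) 0) atTop
      (𝓝 (∫ _ : ℝ, (0 : ℝ))) := by
    refine tendsto_integral_of_dominated_convergence (fun x => a x ^ 2 / (4 * ε))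
      (fun n => (him n).1) (ha.integrable_sq.div_const _)
      (fun n => ae_of_all _ fun x => ?_) (ae_of_all _ fun x => ?_)
    · rw [Real.norm_of_nonneg (le_max_right _ _)]
      refine max_le ?_ (by positivity)
      rw [le_div_iff₀ (by positivity), ← sq_abs (a x), ← sq_abs (r n x)]
      nlinarith [sq_nonneg (|a x| - 2 * ε * |r n x|)]
    · have := ((hlim x).abs.const_mul |a x|).sub (((hlim x).pow 2).const_mul ε)
      have := this.max (tendsto_const_nhds (x := (0 : ℝ)))
      simpa using this
  rw [integral_zero, Metric.tendsto_atTop] at h0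
  obtain ⟨N, hN⟩ := h0 (η / 2) (by positivity)
  refine ⟨N, fun n hn => ?_⟩
  have h1 := hN n hn
  rw [Real.dist_eq, sub_zero] at h1 ⊢
  have h2 : ∫ x, |a x| * |r n x| ≤
      ∫ x, (max (|a x| * |r n x| - ε * r n x ^ 2) 0 + ε * r n x ^ 2) := by
    refine integral_mono (hi n) ((him n).add ((hr n).integrable_sq.const_mul ε)) fun x => ?_
    have := le_max_left (|a x| * |r n x| - ε * r n x ^ 2) 0
    simp only
    linarith
  rw [integral_add (him n) ((hr n).integrable_sq.const_mul ε), integral_const_mul] at h2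
  rw [abs_of_nonneg (integral_nonneg fun x => by positivity)]
  have h3 := le_abs_self (∫ x, max (|a x| * |r n x| - ε * r n x ^ 2) 0)
  have h4 := mul_le_mul_of_nonneg_left (hC n) hε0.le
  linarith

/-- This is Fatou's lemma for the `L²` norm. -/
theorem memLp_of_tendsto {f : ℕ → ℝ → ℝ} (hf : ∀ n, MemLp (f n) 2) {C : ℝ}
    (hC : ∀ n, ∫ x, f n x ^ 2 ≤ C) {F : ℝ → ℝ}
    (hlim : ∀ x, Tendsto (fun n => f n x) atTop (𝓝 (F x))) : MemLp F 2 := by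
  have hm : AEStronglyMeasurable F :=
    aestronglyMeasurable_of_tendsto_ae atTop (fun n => (hf n).1) (ae_of_all _ hlim)
  refine ⟨hm, ?_⟩
  have h1 := Lp.eLpNorm_lim_le_liminf_eLpNorm (p := 2) (fun n => (hf n).1) F (ae_of_all _ hlim)
  refine h1.trans_lt ?_
  have h2 : ∀ n, eLpNorm (f n) 2 volume ≤ ENNReal.ofReal (C ^ (2⁻¹ : ℝ)) := fun n => by
    rw [(hf n).eLpNorm_eq_integral_rpow_norm (by norm_num) (by norm_num)]
    refine ENNReal.ofReal_le_ofReal ?_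
    simp only [ENNReal.toReal_ofNat, Real.rpow_ofNat, Real.norm_eq_abs, sq_abs]
    exact Real.rpow_le_rpow (integral_nonneg fun x => sq_nonneg _) (hC n) (by norm_num)
  exact (liminf_le_of_frequently_le' (Eventually.of_forall h2).frequently).trans_lt
    ENNReal.ofReal_lt_top

/-- Bounded sequences in `H¹(ℝ)` have subsequences that converge weakly and pointwise. -/
theorem IsH1.exists_subseq {f g : ℕ → ℝ → ℝ} (h : ∀ n, IsH1 (f n) (g n)) {C : ℝ}
    (hf : ∀ n, ∫ x, f n x ^ 2 ≤ C) (hg : ∀ n, ∫ x, g n x ^ 2 ≤ C) :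
    ∃ φ : ℕ → ℕ, StrictMono φ ∧ ∃ F G : ℝ → ℝ, IsH1 F G ∧
      (∀ x, Tendsto (fun n => f (φ n) x) atTop (𝓝 (F x))) ∧
      ∀ a : ℝ → ℝ, MemLp a 2 →
        Tendsto (fun n => ∫ x, a x * g (φ n) x) atTop (𝓝 (∫ x, a x * G x)) := by
  obtain ⟨φ, hφ, G, hG, hlim⟩ := exists_weakly_convergent_subseq
    (fun n => (h n).memLp_deriv) hg
  -- Weak convergence of the derivatives controls increments only. A further subsequence makes the
  -- values at `0` converge, and then increments, tested against indicators of intervals, give every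
  -- other point.
  have hb : ∀ n, f (φ n) 0 ∈ Icc (-√(4 * C)) √(4 * C) := fun n => by
    rw [mem_Icc, ← abs_le]
    refine Real.abs_le_sqrt ?_
    have := (h (φ n)).sq_le 0
    linarith [hf (φ n), hg (φ n)]
  obtain ⟨c, -, ψ, hψ, hc⟩ := isCompact_Icc.isSeqCompact hb
  have hi := intervalIntegrable_of_locallyIntegrable (hG.locallyIntegrable (by norm_num))
  set F : ℝ → ℝ := fun x => c + ∫ t in (0:ℝ)..x, G t with hF
  have ind : ∀ (s : Set ℝ), MeasurableSet s → volume s ≠ ⊤ →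
      Tendsto (fun n => ∫ t in s, g (φ n) t) atTop (𝓝 (∫ t in s, G t)) := fun s hs hv => by
    have := hlim (s.indicator fun _ => 1) (memLp_indicator_const 2 hs 1 (Or.inr hv))
    simp_rw [← indicator_mul_left, one_mul, integral_indicator hs] at this
    exact this
  have hpt : ∀ x, Tendsto (fun n => f (φ (ψ n)) x) atTop (𝓝 (F x)) := fun x => by
    have e : ∀ n, f (φ (ψ n)) x = f (φ (ψ n)) 0 + ∫ t in (0:ℝ)..x, g (φ (ψ n)) t := fun n => by
      rw [← (h _).sub_eq]; ring
    simp_rw [e]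
    refine hc.add ?_
    simp_rw [intervalIntegral.intervalIntegral_eq_integral_uIoc]
    exact ((ind _ measurableSet_uIoc (by simp [uIoc])).comp hψ.tendsto_atTop).const_smul _
  refine ⟨φ ∘ ψ, hφ.comp hψ, F, G, ⟨?_, hG, fun x y => ?_⟩, hpt, fun a ha =>
    (hlim a ha).comp hψ.tendsto_atTop⟩
  · exact memLp_of_tendsto (fun n => (h (φ (ψ n))).memLp) (fun n => hf _) hpt
  · simp only [hF]
    rw [add_sub_add_left_eq_sub, intervalIntegral.integral_interval_sub_left (hi _ _) (hi _ _)]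

end WeakCompactness

/-! ### Products of bounded `L²` functions -/

/-- Bounded square integrable functions. -/
structure L2Bdd (f : ℝ → ℝ) : Prop where
  memLp : MemLp f 2
  bdd : ∃ C, ∀ x, |f x| ≤ C

namespace L2Bdd

variable {f g : ℝ → ℝ}

theorem mul (hf : L2Bdd f) (hg : L2Bdd g) : L2Bdd fun x => f x * g x := by
  obtain ⟨C, hC⟩ := hf.bdd
  obtain ⟨D, hD⟩ := hg.bdd
  have hb : ∀ x, |f x * g x| ≤ C * |g x| := fun x => by
    rw [abs_mul]; gcongr; exact hC x
  refine ⟨?_, C * D, fun x => (hb x).trans ?_⟩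
  · refine (hg.memLp.const_mul C).mono (hf.memLp.1.mul hg.memLp.1) (ae_of_all _ fun x => ?_)
    rw [Real.norm_eq_abs, Real.norm_eq_abs, abs_mul C, abs_of_nonneg ((abs_nonneg _).trans (hC 0))]
    exact hb x
  · have := (abs_nonneg _).trans (hC 0)
    gcongr; exact hD x

theorem add (hf : L2Bdd f) (hg : L2Bdd g) : L2Bdd fun x => f x + g x := by
  obtain ⟨C, hC⟩ := hf.bdd
  obtain ⟨D, hD⟩ := hg.bdd
  exact ⟨hf.memLp.add hg.memLp, C + D, fun x => (abs_add_le _ _).trans (add_le_add (hC x) (hD x))⟩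

theorem const_mul (hf : L2Bdd f) (c : ℝ) : L2Bdd fun x => c * f x := by
  obtain ⟨C, hC⟩ := hf.bdd
  exact ⟨hf.memLp.const_mul c, |c| * C, fun x => by rw [abs_mul]; gcongr; exact hC x⟩

theorem sub (hf : L2Bdd f) (hg : L2Bdd g) : L2Bdd fun x => f x - g x := by
  simpa [sub_eq_add_neg] using hf.add (hg.const_mul (-1))

theorem abs (hf : L2Bdd f) : L2Bdd fun x => |f x| :=
  ⟨hf.memLp.abs, by simpa using hf.bdd⟩

theorem integrable_mul (hf : L2Bdd f) (hg : L2Bdd g) : Integrable fun x => f x * g x :=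
  hf.memLp.integrable_mul hg.memLp

end L2Bdd

theorem IsH1.l2Bdd {f g : ℝ → ℝ} (h : IsH1 f g) : L2Bdd f :=
  ⟨h.memLp, _, fun x => Real.abs_le_sqrt (h.sq_le x)⟩

/-! ### The two functionals on real pairs -/

/-- The quadratic functional on real pairs. -/
noncomputable def energy (a b : ℝ) (u u' v v' : ℝ → ℝ) : ℝ :=
  ∫ x, (u' x ^ 2 + v' x ^ 2 + a * u x ^ 2 + b * v x ^ 2)

/-- The quartic functional on real pairs. -/
noncomputable def quartic (u v : ℝ → ℝ) : ℝ :=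
  ∫ x, (3 * (u x ^ 4 + v x ^ 4 + 4 * u x ^ 2 * v x ^ 2) + 4 * (u x ^ 3 * v x))

section Pairs

variable {a b : ℝ} {u u' v v' r r' s s' : ℝ → ℝ}

theorem integrable_energy (hu : IsH1 u u') (hv : IsH1 v v') (a b : ℝ) :
    Integrable fun x => u' x ^ 2 + v' x ^ 2 + a * u x ^ 2 + b * v x ^ 2 :=
  ((hu.integrable_deriv_sq.add hv.integrable_deriv_sq).add (hu.integrable_sq.const_mul a)).add
    (hv.integrable_sq.const_mul b)

theorem integrable_quartic (hu : L2Bdd u) (hv : L2Bdd v) :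
    Integrable fun x => 3 * (u x ^ 4 + v x ^ 4 + 4 * u x ^ 2 * v x ^ 2) + 4 * (u x ^ 3 * v x) := by
  have e : ∀ x, 3 * (u x ^ 4 + v x ^ 4 + 4 * u x ^ 2 * v x ^ 2) + 4 * (u x ^ 3 * v x)
      = 3 * ((u x * u x) * (u x * u x) + (v x * v x) * (v x * v x)
        + 4 * ((u x * u x) * (v x * v x))) + 4 * ((u x * u x) * (u x * v x)) := fun x => by ring
  simp_rw [e]
  exact (((((hu.mul hu).integrable_mul (hu.mul hu)).add
    ((hv.mul hv).integrable_mul (hv.mul hv))).add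
    (((hu.mul hu).integrable_mul (hv.mul hv)).const_mul 4)).const_mul 3).add
    (((hu.mul hu).integrable_mul (hu.mul hv)).const_mul 4)

theorem energy_nonneg (ha : 0 ≤ a) (hb : 0 ≤ b) : 0 ≤ energy a b u u' v v' :=
  integral_nonneg fun x => by positivity

theorem integral_sq_le_energy (ha : 0 < a) (hb : 0 < b) (hu : IsH1 u u') (hv : IsH1 v v') :
    (∫ x, u x ^ 2) ≤ energy a b u u' v v' / a ∧ (∫ x, v x ^ 2) ≤ energy a b u u' v v' / b ∧
    (∫ x, u' x ^ 2) ≤ energy a b u u' v v' ∧ (∫ x, v' x ^ 2) ≤ energy a b u u' v v' := by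
  have h := integrable_energy hu hv a b
  refine ⟨?_, ?_, ?_, ?_⟩
  · rw [le_div_iff₀' ha, ← integral_const_mul]
    exact integral_mono (hu.integrable_sq.const_mul a) h fun x => by
      have := sq_nonneg (u' x); have := sq_nonneg (v' x); have := mul_nonneg hb.le (sq_nonneg (v x))
      simp only; linarith
  · rw [le_div_iff₀' hb, ← integral_const_mul]
    exact integral_mono (hv.integrable_sq.const_mul b) h fun x => by
      have := sq_nonneg (u' x); have := sq_nonneg (v' x); have := mul_nonneg ha.le (sq_nonneg (u x))
      simp only; linarith
  · exact integral_mono hu.integrable_deriv_sq h fun x => by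
      have := sq_nonneg (v' x); have := mul_nonneg ha.le (sq_nonneg (u x))
      have := mul_nonneg hb.le (sq_nonneg (v x))
      simp only; linarith
  · exact integral_mono hv.integrable_deriv_sq h fun x => by
      have := sq_nonneg (u' x); have := mul_nonneg ha.le (sq_nonneg (u x))
      have := mul_nonneg hb.le (sq_nonneg (v x))
      simp only; linarith

/-- Since `4 * x ^ 3 * y ≤ 2 * x ^ 4 + 2 * x ^ 2 * y ^ 2`, the coefficient of `x ^ 2 * y ^ 2`
becomes `14 = 2 * 7`. -/
theorem quartic_density_le (x y : ℝ) :
    3 * (x ^ 4 + y ^ 4 + 4 * x ^ 2 * y ^ 2) + 4 * (x ^ 3 * y) ≤ 7 * (x ^ 2 + y ^ 2) ^ 2 := by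
  nlinarith [mul_nonneg (sq_nonneg x) (sq_nonneg (x - y)), sq_nonneg (x ^ 2), sq_nonneg (y ^ 2),
    mul_nonneg (sq_nonneg x) (sq_nonneg y)]

/-- Of the four powers, two are paid by the sup bound and two by the `L²` norm. This is what
excludes vanishing of a maximizing sequence. -/
theorem quartic_le_of_forall_le (hu : L2Bdd u) (hv : L2Bdd v) {δ : ℝ}
    (h : ∀ x, u x ^ 2 + v x ^ 2 ≤ δ) :
    quartic u v ≤ 7 * δ * ((∫ x, u x ^ 2) + ∫ x, v x ^ 2) := by
  rw [← integral_add hu.memLp.integrable_sq hv.memLp.integrable_sq, ← integral_const_mul]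
  refine integral_mono (integrable_quartic hu hv)
    ((hu.memLp.integrable_sq.add hv.memLp.integrable_sq).const_mul _) fun x => ?_
  refine (quartic_density_le _ _).trans ?_
  have h0 : 0 ≤ u x ^ 2 + v x ^ 2 := by positivity
  have := mul_le_mul_of_nonneg_right (h x) h0
  linarith

theorem quartic_le_mul_energy_sq (ha : 0 < a) (hb : 0 < b) (hu : IsH1 u u') (hv : IsH1 v v') :
    quartic u v ≤ 7 * (2 * (1 / a + 1 / b + 2)) * (1 / a + 1 / b) * energy a b u u' v v' ^ 2 := by
  obtain ⟨h1, h2, h3, h4⟩ := integral_sq_le_energy ha hb hu hv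
  have hE : 0 ≤ energy a b u u' v v' := energy_nonneg ha.le hb.le
  set e := energy a b u u' v v'
  refine (quartic_le_of_forall_le hu.l2Bdd hv.l2Bdd (δ := 2 * (1 / a + 1 / b + 2) * e)
    fun x => ?_).trans ?_
  · have := hu.sq_le x
    have := hv.sq_le x
    have e1 : 2 * (1 / a + 1 / b + 2) * e = 2 * (e / a + e / b + 2 * e) := by ring
    rw [e1]; linarith
  · have e1 : 7 * (2 * (1 / a + 1 / b + 2)) * (1 / a + 1 / b) * e ^ 2
      = 7 * (2 * (1 / a + 1 / b + 2) * e) * (e / a + e / b) := by ring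
    rw [e1]
    gcongr

/-- The mixed terms in the quartic density are controlled by products of the two summands. -/
theorem abs_quartic_density_add_sub_le {L u v r s : ℝ} (hu : |u| ≤ L) (hv : |v| ≤ L)
    (hr : |r| ≤ L) (hs : |s| ≤ L) :
    |(3 * ((u + r) ^ 4 + (v + s) ^ 4 + 4 * (u + r) ^ 2 * (v + s) ^ 2)
        + 4 * ((u + r) ^ 3 * (v + s)))
      - (3 * (u ^ 4 + v ^ 4 + 4 * u ^ 2 * v ^ 2) + 4 * (u ^ 3 * v))
      - (3 * (r ^ 4 + s ^ 4 + 4 * r ^ 2 * s ^ 2) + 4 * (r ^ 3 * s))|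
      ≤ 200 * L ^ 2 * ((|u| + |v|) * (|r| + |s|)) := by
  have hp : ∀ x y : ℝ, |x| ≤ L → |y| ≤ L → -L ^ 2 ≤ x * y ∧ x * y ≤ L ^ 2 := fun x y hx hy => by
    rw [← abs_le, abs_mul, sq]
    exact mul_le_mul hx hy (abs_nonneg _) ((abs_nonneg _).trans hx)
  have h1 := hp u u hu hu
  have h2 := hp u v hu hv
  have h3 := hp u r hu hr
  have h4 := hp u s hu hs
  have h5 := hp v v hv hv
  have h6 := hp v r hv hr
  have h7 := hp v s hv hs
  have h8 := hp r r hr hr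
  have h9 := hp r s hr hs
  have h10 := hp s s hs hs
  -- Each mixed monomial contains one of `u, v` and one of `r, s`; `A, B, C, D` collect the
  -- quadratic cofactors of `u r`, `u s`, `v r`, `v s`. The worst is `A`, with bound `186 * L ^ 2`.
  set A := 3 * (4 * u ^ 2 + 6 * u * r + 4 * r ^ 2) + 24 * (v + s) ^ 2 + 12 * (u + r) * (v + s)
  set B := 12 * u * (2 * v + s) + 4 * u ^ 2
  set C := 12 * r * (v + 2 * s) + 4 * r ^ 2
  set D := 3 * (4 * v ^ 2 + 6 * v * s + 4 * s ^ 2)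
  have hA : |A| ≤ 200 * L ^ 2 := by
    rw [abs_le]; constructor <;> (simp only [A]; ring_nf; nlinarith)
  have hB : |B| ≤ 200 * L ^ 2 := by
    rw [abs_le]; constructor <;> (simp only [B]; ring_nf; nlinarith)
  have hC : |C| ≤ 200 * L ^ 2 := by
    rw [abs_le]; constructor <;> (simp only [C]; ring_nf; nlinarith)
  have hD : |D| ≤ 200 * L ^ 2 := by
    rw [abs_le]; constructor <;> (simp only [D]; ring_nf; nlinarith)
  have e : (3 * ((u + r) ^ 4 + (v + s) ^ 4 + 4 * (u + r) ^ 2 * (v + s) ^ 2)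
        + 4 * ((u + r) ^ 3 * (v + s)))
      - (3 * (u ^ 4 + v ^ 4 + 4 * u ^ 2 * v ^ 2) + 4 * (u ^ 3 * v))
      - (3 * (r ^ 4 + s ^ 4 + 4 * r ^ 2 * s ^ 2) + 4 * (r ^ 3 * s))
      = A * (u * r) + B * (u * s) + C * (v * r) + D * (v * s) := by
    simp only [A, B, C, D]; ring
  rw [e]
  have t : ∀ X x y : ℝ, |X| ≤ 200 * L ^ 2 → |X * (x * y)| ≤ 200 * L ^ 2 * (|x| * |y|) :=
    fun X x y hX => by
      rw [abs_mul, abs_mul]; gcongr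
  calc _ ≤ |A * (u * r)| + |B * (u * s)| + |C * (v * r)| + |D * (v * s)| := by
        refine (abs_add_le _ _).trans (add_le_add_left ((abs_add_le _ _).trans
          (add_le_add_left (abs_add_le _ _) _)) _)
    _ ≤ _ := by
        have := t A u r hA; have := t B u s hB; have := t C v r hC; have := t D v s hD
        linarith

end Pairs

theorem integrable_fun_sub {f g : ℝ → ℝ} (hf : Integrable f) (hg : Integrable g) :
    Integrable fun x => f x - g x := hf.sub hg

/-! ### Existence of an even nonnegative maximizer -/

section Maximizer

variable {a b : ℝ} {u u' v v' : ℕ → ℝ → ℝ} {U U' V V' : ℝ → ℝ}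

theorem integral_sub_sq_le {f F : ℝ → ℝ} (hf : MemLp f 2) (hF : MemLp F 2) {C : ℝ}
    (hC : ∫ x, f x ^ 2 ≤ C) : ∫ x, (f x - F x) ^ 2 ≤ 2 * C + 2 * ∫ x, F x ^ 2 := by
  have h : ∫ x, (f x - F x) ^ 2 ≤ ∫ x, (2 * f x ^ 2 + 2 * F x ^ 2) := by
    refine integral_mono (hf.sub hF).integrable_sq
      ((hf.integrable_sq.const_mul 2).add (hF.integrable_sq.const_mul 2)) fun x => ?_
    simp only
    nlinarith [sq_nonneg (f x + F x)]
  rw [integral_add (hf.integrable_sq.const_mul 2) (hF.integrable_sq.const_mul 2),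
    integral_const_mul, integral_const_mul] at h
  linarith

theorem tendsto_integral_mul_sub {f : ℕ → ℝ → ℝ} {F A : ℝ → ℝ} (hA : MemLp A 2)
    (hf : ∀ n, MemLp (f n) 2) (hF : MemLp F 2) {C : ℝ} (hC : ∀ n, ∫ x, f n x ^ 2 ≤ C)
    (hlim : ∀ x, Tendsto (fun n => f n x) atTop (𝓝 (F x))) :
    Tendsto (fun n => ∫ x, A x * (f n x - F x)) atTop (𝓝 0) := by
  have h := tendsto_integral_abs_mul_of_tendsto_zero hA (fun n => (hf n).sub hF)
    (fun n => integral_sub_sq_le (hf n) hF (hC n)) fun x => by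
      simpa using (hlim x).sub_const (F x)
  refine squeeze_zero_norm (fun n => ?_) h
  refine (norm_integral_le_integral_norm _).trans_eq ?_
  simp

/-- For a quadratic form the defect is twice the pairing of the limit with the remainder. The
derivative terms vanish by weak convergence, the others by boundedness and pointwise convergence. -/
theorem tendsto_energy_split (hu : ∀ n, IsH1 (u n) (u' n)) (hv : ∀ n, IsH1 (v n) (v' n))
    (hU : IsH1 U U') (hV : IsH1 V V') {C : ℝ}
    (hu2 : ∀ n, ∫ x, u n x ^ 2 ≤ C) (hv2 : ∀ n, ∫ x, v n x ^ 2 ≤ C)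
    (hul : ∀ x, Tendsto (fun n => u n x) atTop (𝓝 (U x)))
    (hvl : ∀ x, Tendsto (fun n => v n x) atTop (𝓝 (V x)))
    (hu'l : ∀ A, MemLp A 2 → Tendsto (fun n => ∫ x, A x * u' n x) atTop (𝓝 (∫ x, A x * U' x)))
    (hv'l : ∀ A, MemLp A 2 → Tendsto (fun n => ∫ x, A x * v' n x) atTop (𝓝 (∫ x, A x * V' x))) :
    Tendsto (fun n => energy a b (u n) (u' n) (v n) (v' n) - energy a b U U' V V'
      - energy a b (fun x => u n x - U x) (fun x => u' n x - U' x)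
          (fun x => v n x - V x) (fun x => v' n x - V' x)) atTop (𝓝 0) := by
  have w : ∀ {f : ℕ → ℝ → ℝ} {F A : ℝ → ℝ}, MemLp A 2 → (∀ n, MemLp (f n) 2) → MemLp F 2 →
      (∀ A, MemLp A 2 → Tendsto (fun n => ∫ x, A x * f n x) atTop (𝓝 (∫ x, A x * F x))) →
      Tendsto (fun n => ∫ x, A x * (f n x - F x)) atTop (𝓝 0) := by
    intro f F A hA hf hF h
    have := (h A hA).sub_const (∫ x, A x * F x)
    rw [sub_self] at this
    refine this.congr fun n => ?_
    have j1 : Integrable fun x => A x * f n x := hA.integrable_mul (hf n)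
    have j2 : Integrable fun x => A x * F x := hA.integrable_mul hF
    rw [← integral_sub j1 j2]
    exact integral_congr_ae (ae_of_all _ fun x => (mul_sub _ _ _).symm)
  have t1 := w hU.memLp_deriv (fun n => (hu n).memLp_deriv) hU.memLp_deriv hu'l
  have t2 := w hV.memLp_deriv (fun n => (hv n).memLp_deriv) hV.memLp_deriv hv'l
  have t3 := tendsto_integral_mul_sub hU.memLp (fun n => (hu n).memLp) hU.memLp hu2 hul
  have t4 := tendsto_integral_mul_sub hV.memLp (fun n => (hv n).memLp) hV.memLp hv2 hvl
  have t := (((t1.const_mul 2).add (t2.const_mul 2)).add (t3.const_mul (2 * a))).add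
    (t4.const_mul (2 * b))
  simp only [mul_zero, add_zero] at t
  refine t.congr fun n => ?_
  have hr := (hu n).sub hU
  have hs := (hv n).sub hV
  have i1 := (hU.memLp_deriv.integrable_mul hr.memLp_deriv).const_mul 2
  have i2 := (hV.memLp_deriv.integrable_mul hs.memLp_deriv).const_mul 2
  have i3 := (hU.memLp.integrable_mul hr.memLp).const_mul (2 * a)
  have i4 := (hV.memLp.integrable_mul hs.memLp).const_mul (2 * b)
  simp only [Pi.mul_apply] at i1 i2 i3 i4
  simp only [energy]
  rw [← integral_sub (integrable_energy (hu n) (hv n) a b) (integrable_energy hU hV a b),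
    ← integral_sub (integrable_fun_sub (integrable_energy (hu n) (hv n) a b) (integrable_energy hU hV a b))
      (integrable_energy hr hs a b),
    ← integral_const_mul, ← integral_const_mul, ← integral_const_mul, ← integral_const_mul,
    ← integral_add i1 i2, ← integral_add (i1.fun_add i2) i3, ← integral_add ((i1.fun_add i2).fun_add i3) i4]
  exact integral_congr_ae (ae_of_all _ fun x => by simp only; ring)

/-- A Brezis–Lieb splitting: uniform sup bounds reduce the mixed terms to a fixed `L²` function
times an `L²`-bounded remainder that tends to zero pointwise. -/
theorem tendsto_quartic_split (hu : ∀ n, L2Bdd (u n)) (hv : ∀ n, L2Bdd (v n))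
    (hU : L2Bdd U) (hV : L2Bdd V) {C L : ℝ}
    (hu2 : ∀ n, ∫ x, u n x ^ 2 ≤ C) (hv2 : ∀ n, ∫ x, v n x ^ 2 ≤ C)
    (huL : ∀ n x, |u n x| ≤ L) (hvL : ∀ n x, |v n x| ≤ L)
    (hul : ∀ x, Tendsto (fun n => u n x) atTop (𝓝 (U x)))
    (hvl : ∀ x, Tendsto (fun n => v n x) atTop (𝓝 (V x))) :
    Tendsto (fun n => quartic (u n) (v n) - quartic U V
      - quartic (fun x => u n x - U x) (fun x => v n x - V x)) atTop (𝓝 0) := by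
  have hUL : ∀ x, |U x| ≤ L := fun x => le_of_tendsto' (hul x).abs fun n => huL n x
  have hVL : ∀ x, |V x| ≤ L := fun x => le_of_tendsto' (hvl x).abs fun n => hvL n x
  have hL0 : 0 ≤ L := (abs_nonneg _).trans (hUL 0)
  have hr := fun n => (hu n).sub hU
  have hs := fun n => (hv n).sub hV
  have t := tendsto_integral_abs_mul_of_tendsto_zero (hU.abs.add hV.abs).memLp
    (r := fun n x => |u n x - U x| + |v n x - V x|)
    (fun n => ((hr n).abs.add (hs n).abs).memLp)
    (C := 2 * (2 * C + 2 * ∫ x, U x ^ 2) + 2 * (2 * C + 2 * ∫ x, V x ^ 2)) (fun n => ?_)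
    fun x => by
      simpa using ((hul x).sub_const (U x)).abs.add ((hvl x).sub_const (V x)).abs
  · have t' := t.const_mul (200 * (2 * L) ^ 2)
    rw [mul_zero] at t'
    refine squeeze_zero_norm (fun n => ?_) t'
    have j1 := integrable_quartic (hu n) (hv n)
    have j2 := integrable_quartic hU hV
    have j3 := integrable_quartic (hr n) (hs n)
    simp only [quartic]
    rw [← integral_sub j1 j2, ← integral_sub (integrable_fun_sub j1 j2) j3, ← integral_const_mul]
    refine (norm_integral_le_integral_norm _).trans ?_
    refine integral_mono (integrable_fun_sub (integrable_fun_sub j1 j2) j3).norm (Integrable.const_mul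
      ((hU.abs.add hV.abs).abs.integrable_mul ((hr n).abs.add (hs n).abs).abs) _) fun x => ?_
    have hd : ∀ p q : ℝ, |p| ≤ L → |q| ≤ L → |p - q| ≤ 2 * L := fun p q hp hq =>
      (abs_sub _ _).trans (by linarith)
    have key := abs_quartic_density_add_sub_le (L := 2 * L) (u := U x) (v := V x)
      (r := u n x - U x) (s := v n x - V x) ((hUL x).trans (by linarith))
      ((hVL x).trans (by linarith)) (hd _ _ (huL n x) (hUL x)) (hd _ _ (hvL n x) (hVL x))
    simp only [add_sub_cancel] at key
    simp only [Real.norm_eq_abs]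
    rwa [abs_of_nonneg (add_nonneg (abs_nonneg (U x)) (abs_nonneg (V x))),
      abs_of_nonneg (add_nonneg (abs_nonneg (u n x - U x)) (abs_nonneg (v n x - V x)))]
  · have i1 := (hr n).memLp.integrable_sq.const_mul 2
    have i2 := (hs n).memLp.integrable_sq.const_mul 2
    have h : ∫ x, (|u n x - U x| + |v n x - V x|) ^ 2 ≤
        ∫ x, (2 * (u n x - U x) ^ 2 + 2 * (v n x - V x) ^ 2) := by
      refine integral_mono ((hr n).abs.add (hs n).abs).memLp.integrable_sq (i1.add i2) fun x => ?_
      simp only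
      rw [← sq_abs (u n x - U x), ← sq_abs (v n x - V x)]
      nlinarith [sq_nonneg (|u n x - U x| - |v n x - V x|)]
    rw [integral_add i1 i2, integral_const_mul, integral_const_mul] at h
    have := integral_sub_sq_le (hu n).memLp hU.memLp (hu2 n)
    have := integral_sub_sq_le (hv n).memLp hV.memLp (hv2 n)
    linarith

/-- Existence of a nonnegative maximizer of the quartic functional at fixed energy. -/
theorem exists_maximizer (ha : 0 < a) (hb : 0 < b) {M : ℝ} (hM0 : 0 < M)
    (hM : ∀ {u u' v v' : ℝ → ℝ}, IsH1 u u' → IsH1 v v' →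
      quartic u v ≤ M * energy a b u u' v v' ^ 2)
    (hseq : ∀ ε > 0, ∃ u u' v v' : ℝ → ℝ, IsH1 u u' ∧ IsH1 v v' ∧ (∀ x, 0 ≤ u x) ∧
      (∀ x, 0 ≤ v x) ∧ energy a b u u' v v' ≤ 1 ∧ M - ε ≤ quartic u v) :
    ∃ u u' v v' : ℝ → ℝ, IsH1 u u' ∧ IsH1 v v' ∧ (∀ x, 0 ≤ u x) ∧
      (∀ x, 0 ≤ v x) ∧ energy a b u u' v v' = 1 ∧ quartic u v = M := by
  set C := 1 + 1 / a + 1 / b with hC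
  have ha' : 0 < 1 / a := by positivity
  have hb' : 0 < 1 / b := by positivity
  have hC0 : 0 < C := by positivity
  -- Chosen so that `7 * δ * C = M / 2`: a pair with `u ^ 2 + v ^ 2 ≤ δ` everywhere has quartic
  -- value at most `M / 2`.
  set δ := M / (14 * C) with hδ
  have hδ0 : 0 < δ := by positivity
  have hseq' : ∀ n : ℕ, ∃ w : (ℝ → ℝ) × (ℝ → ℝ) × (ℝ → ℝ) × (ℝ → ℝ),
      IsH1 w.1 w.2.1 ∧ IsH1 w.2.2.1 w.2.2.2 ∧ (∀ x, 0 ≤ w.1 x) ∧ (∀ x, 0 ≤ w.2.2.1 x) ∧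
      energy a b w.1 w.2.1 w.2.2.1 w.2.2.2 ≤ 1 ∧
      M - M / (n + 3) ≤ quartic w.1 w.2.2.1 ∧ δ ≤ w.1 0 ^ 2 + w.2.2.1 0 ^ 2 := by
    intro n
    -- The `3` keeps the value at least `2 * M / 3`, hence above `M / 2`, already for `n = 0`.
    obtain ⟨u, u', v, v', hu, hv, hu0, hv0, hE, hQ⟩ := hseq (M / (n + 3)) (by positivity)
    obtain ⟨c, hc⟩ : ∃ c, δ ≤ u c ^ 2 + v c ^ 2 := by
      by_contra! hcon
      have h1 := quartic_le_of_forall_le hu.l2Bdd hv.l2Bdd fun x => (hcon x).le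
      obtain ⟨h2, h3, -, -⟩ := integral_sq_le_energy ha hb hu hv
      have h4 : (∫ x, u x ^ 2) + ∫ x, v x ^ 2 ≤ C := by
        have := div_le_div_of_nonneg_right hE ha.le
        have := div_le_div_of_nonneg_right hE hb.le
        linarith
      have h5 := mul_le_mul_of_nonneg_left h4 (show 0 ≤ 7 * δ by positivity)
      have h6 : 7 * δ * C = M / 2 := by rw [hδ]; field_simp; norm_num
      have h7 : M / (n + 3) ≤ M / 3 := by
        gcongr; linarith [(Nat.cast_nonneg n : (0:ℝ) ≤ n)]
      linarith
    refine ⟨(fun x => u (x + c), fun x => u' (x + c), fun x => v (x + c), fun x => v' (x + c)),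
      hu.comp_add_right c, hv.comp_add_right c, fun x => hu0 _, fun x => hv0 _, ?_, ?_, ?_⟩
    · refine Eq.trans_le ?_ hE
      exact integral_add_right_eq_self
        (fun x => u' x ^ 2 + v' x ^ 2 + a * u x ^ 2 + b * v x ^ 2) c
    · refine hQ.trans_eq ?_
      exact (integral_add_right_eq_self
        (fun x => 3 * (u x ^ 4 + v x ^ 4 + 4 * u x ^ 2 * v x ^ 2) + 4 * (u x ^ 3 * v x)) c).symm
    · simpa using hc
  choose w hu hv hu0 hv0 hE hQ hw using hseq'
  have hb1 := fun n => integral_sq_le_energy ha hb (hu n) (hv n)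
  have hEa : ∀ n, energy a b (w n).1 (w n).2.1 (w n).2.2.1 (w n).2.2.2 / a ≤ 1 / a :=
    fun n => div_le_div_of_nonneg_right (hE n) ha.le
  have hEb : ∀ n, energy a b (w n).1 (w n).2.1 (w n).2.2.1 (w n).2.2.2 / b ≤ 1 / b :=
    fun n => div_le_div_of_nonneg_right (hE n) hb.le
  have bu : ∀ n, ∫ x, (w n).1 x ^ 2 ≤ C := fun n => by linarith [(hb1 n).1, hEa n]
  have bv : ∀ n, ∫ x, (w n).2.2.1 x ^ 2 ≤ C := fun n => by linarith [(hb1 n).2.1, hEb n]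
  have bu' : ∀ n, ∫ x, (w n).2.1 x ^ 2 ≤ C := fun n => by linarith [(hb1 n).2.2.1, hE n]
  have bv' : ∀ n, ∫ x, (w n).2.2.2 x ^ 2 ≤ C := fun n => by linarith [(hb1 n).2.2.2, hE n]
  obtain ⟨φ, hφ, U, U', hU, hUl, hU'l⟩ := IsH1.exists_subseq hu bu bu'
  obtain ⟨ψ, hψ, V, V', hV, hVl, hV'l⟩ := IsH1.exists_subseq (fun n => hv (φ n))
    (fun n => bv _) (fun n => bv' _)
  have hψt := hψ.tendsto_atTop
  set k : ℕ → ℕ := fun n => φ (ψ n) with hk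
  have hkt : Tendsto k atTop atTop := hφ.tendsto_atTop.comp hψt
  have hUl' : ∀ x, Tendsto (fun n => (w (k n)).1 x) atTop (𝓝 (U x)) :=
    fun x => (hUl x).comp hψt
  have sup : ∀ {f g : ℝ → ℝ}, IsH1 f g → ∫ x, f x ^ 2 ≤ C → ∫ x, g x ^ 2 ≤ C →
      ∀ x, |f x| ≤ √(4 * C) := fun h h1 h2 x =>
    Real.abs_le_sqrt ((h.sq_le x).trans (by linarith))
  have sE := tendsto_energy_split (a := a) (b := b) (fun n => hu (k n)) (fun n => hv (k n)) hU hV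
    (fun n => bu _) (fun n => bv _) hUl' hVl (fun A hA => (hU'l A hA).comp hψt) hV'l
  have sQ := tendsto_quartic_split (fun n => (hu (k n)).l2Bdd) (fun n => (hv (k n)).l2Bdd)
    hU.l2Bdd hV.l2Bdd (fun n => bu _) (fun n => bv _)
    (fun n => sup (hu (k n)) (bu _) (bu' _)) (fun n => sup (hv (k n)) (bv _) (bv' _)) hUl' hVl
  have hU0 : ∀ x, 0 ≤ U x := fun x => ge_of_tendsto' (hUl' x) fun n => hu0 _ x
  have hV0 : ∀ x, 0 ≤ V x := fun x => ge_of_tendsto' (hVl x) fun n => hv0 _ x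
  set θ := energy a b U U' V V' with hθ
  -- The lower bound `δ` at the origin survives the pointwise limit, so the limit has positive
  -- energy by the sup estimate.
  have hθ0 : 0 < θ := by
    have h1 : δ ≤ U 0 ^ 2 + V 0 ^ 2 :=
      ge_of_tendsto' (((hUl' 0).pow 2).add ((hVl 0).pow 2)) fun n => hw _
    have h2 := hU.sq_le 0
    have h3 := hV.sq_le 0
    obtain ⟨h4, h5, h6, h7⟩ := integral_sq_le_energy ha hb hU hV
    rw [← hθ] at h4 h5 h6 h7
    have h8 : δ ≤ 2 * (1 / a + 1 / b + 2) * θ := by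
      have e1 : 2 * (1 / a + 1 / b + 2) * θ = 2 * (θ / a + θ / b + 2 * θ) := by ring
      rw [e1]; linarith
    by_contra! h9
    have : 2 * (1 / a + 1 / b + 2) * θ ≤ 0 := mul_nonpos_of_nonneg_of_nonpos (by positivity) h9
    linarith
  set e : ℕ → ℝ := fun n => energy a b (w (k n)).1 (w (k n)).2.1 (w (k n)).2.2.1 (w (k n)).2.2.2
    - θ - energy a b (fun x => (w (k n)).1 x - U x) (fun x => (w (k n)).2.1 x - U' x)
      (fun x => (w (k n)).2.2.1 x - V x) (fun x => (w (k n)).2.2.2 x - V' x) with he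
  set ρ : ℕ → ℝ := fun n => energy a b (fun x => (w (k n)).1 x - U x)
    (fun x => (w (k n)).2.1 x - U' x) (fun x => (w (k n)).2.2.1 x - V x)
    (fun x => (w (k n)).2.2.2 x - V' x) with hρ
  have hρ0 : ∀ n, 0 ≤ ρ n := fun n => energy_nonneg ha.le hb.le
  have hρ1 : ∀ n, ρ n ≤ 1 - θ - e n := fun n => by
    have := hE (k n)
    simp only [he, hρ]
    linarith
  have hθ1 : θ ≤ 1 := by
    have : Tendsto (fun n => 1 - θ - e n) atTop (𝓝 (1 - θ - 0)) := sE.const_sub _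
    have := ge_of_tendsto' this fun n => (hρ0 n).trans (hρ1 n)
    linarith
  -- The remainder's quartic value is bounded through `hM` by `M` times its squared energy, and that
  -- energy is at most `1 - θ` up to the splitting error.
  have hQn : ∀ n, M - M / ((k n : ℝ) + 3) - (quartic (w (k n)).1 (w (k n)).2.2.1 - quartic U V
      - quartic (fun x => (w (k n)).1 x - U x) (fun x => (w (k n)).2.2.1 x - V x))
      ≤ quartic U V + M * (1 - θ - e n) ^ 2 := fun n => by
    have h1 := hQ (k n)
    have h2 := hM ((hu (k n)).sub hU) ((hv (k n)).sub hV)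
    have h3 : ρ n ^ 2 ≤ (1 - θ - e n) ^ 2 := pow_le_pow_left₀ (hρ0 n) (hρ1 n) 2
    have h4 := mul_le_mul_of_nonneg_left h3 hM0.le
    linarith
  have lim1 : Tendsto (fun n => M / ((k n : ℝ) + 3)) atTop (𝓝 0) :=
    (tendsto_const_nhds.div_atTop (tendsto_atTop_add_const_right _ _
      (tendsto_natCast_atTop_atTop.comp hkt)))
  have final : M ≤ quartic U V + M * (1 - θ) ^ 2 := by
    have l1 := (lim1.const_sub M).sub sQ
    have l2 := (((sE.const_sub (1 - θ)).pow 2).const_mul M).const_add (quartic U V)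
    have := le_of_tendsto_of_tendsto' l1 l2 hQn
    simpa using this
  have hQU := hM hU hV
  rw [← hθ] at hQU
  -- Strict convexity: `θ ^ 2 + (1 - θ) ^ 2 ≥ 1` with `0 < θ ≤ 1` leaves only `θ = 1`, so no energy
  -- escapes.
  have hθ_eq : θ = 1 := by
    have h1 : 0 ≤ M * (θ ^ 2 + (1 - θ) ^ 2 - 1) := by linarith
    have h2 : 0 ≤ θ ^ 2 + (1 - θ) ^ 2 - 1 := nonneg_of_mul_nonneg_right h1 hM0
    have h3 : 0 ≤ θ * (θ - 1) := by nlinarith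
    have h4 : 0 ≤ θ - 1 := nonneg_of_mul_nonneg_right h3 hθ0
    linarith
  refine ⟨U, U', V, V', hU, hV, hU0, hV0, hθ_eq, ?_⟩
  rw [hθ_eq] at hQU final
  refine le_antisymm (by simpa using hQU) (by simpa using final)

/-- A maximizer can be made even: cut the line into two halves of equal energy, and reflect the
half which carries more of the quartic functional. -/
theorem exists_even_maximizer {M : ℝ}
    (hM : ∀ {u u' v v' : ℝ → ℝ}, IsH1 u u' → IsH1 v v' →
      quartic u v ≤ M * energy a b u u' v v' ^ 2)
    (hex : ∃ u u' v v' : ℝ → ℝ, IsH1 u u' ∧ IsH1 v v' ∧ (∀ x, 0 ≤ u x) ∧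
      (∀ x, 0 ≤ v x) ∧ energy a b u u' v v' = 1 ∧ quartic u v = M) :
    ∃ u u' v v' : ℝ → ℝ, IsH1 u u' ∧ IsH1 v v' ∧ (∀ x, 0 ≤ u x) ∧
      (∀ x, 0 ≤ v x) ∧ energy a b u u' v v' = 1 ∧ quartic u v = M ∧
      Function.Even u ∧ Function.Even v := by
  obtain ⟨u, u', v, v', hu, hv, hu0, hv0, hE, hQ⟩ := hex
  -- Reflecting doubles both half-line integrals: energy `1` and quartic value at least `M`, hence
  -- exactly `M` by `hM`.
  have half : ∀ {u u' v v' : ℝ → ℝ}, IsH1 u u' → IsH1 v v' → (∀ x, 0 ≤ u x) → (∀ x, 0 ≤ v x) →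
      ∫ x in Ioi 0, (u' x ^ 2 + v' x ^ 2 + a * u x ^ 2 + b * v x ^ 2) = 1 / 2 →
      M / 2 ≤ ∫ x in Ioi 0,
        (3 * (u x ^ 4 + v x ^ 4 + 4 * u x ^ 2 * v x ^ 2) + 4 * (u x ^ 3 * v x)) →
      ∃ u u' v v' : ℝ → ℝ, IsH1 u u' ∧ IsH1 v v' ∧ (∀ x, 0 ≤ u x) ∧
        (∀ x, 0 ≤ v x) ∧ energy a b u u' v v' = 1 ∧ quartic u v = M ∧
        Function.Even u ∧ Function.Even v := by
    intro u u' v v' hu hv hu0 hv0 hE hQ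
    have e1 : energy a b (fun x => u |x|) (fun x => (if 0 ≤ x then 1 else -1) * u' |x|)
        (fun x => v |x|) (fun x => (if 0 ≤ x then 1 else -1) * v' |x|) = 1 := by
      have : ∀ x y : ℝ, ((if 0 ≤ x then 1 else -1) * y) ^ 2 = y ^ 2 := fun x y => by
        split_ifs <;> ring
      simp only [energy, this]
      rw [integral_comp_abs (f := fun x => u' x ^ 2 + v' x ^ 2 + a * u x ^ 2 + b * v x ^ 2), hE]
      norm_num
    have e2 : M ≤ quartic (fun x => u |x|) (fun x => v |x|) := by
      simp only [quartic]
      rw [integral_comp_abs (f := fun x => 3 * (u x ^ 4 + v x ^ 4 + 4 * u x ^ 2 * v x ^ 2)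
        + 4 * (u x ^ 3 * v x))]
      linarith
    have e3 := hM hu.comp_abs hv.comp_abs
    rw [e1, one_pow, mul_one] at e3
    exact ⟨_, _, _, _, hu.comp_abs, hv.comp_abs, fun x => hu0 _, fun x => hv0 _, e1,
      le_antisymm e3 e2, fun x => by simp only [abs_neg], fun x => by simp only [abs_neg]⟩
  have hi := integrable_energy hu hv a b
  have hq := integrable_quartic hu.l2Bdd hv.l2Bdd
  set ρ : ℝ → ℝ := fun x => u' x ^ 2 + v' x ^ 2 + a * u x ^ 2 + b * v x ^ 2 with hρ
  set κ : ℝ → ℝ := fun x => 3 * (u x ^ 4 + v x ^ 4 + 4 * u x ^ 2 * v x ^ 2) + 4 * (u x ^ 3 * v x)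
    with hκ
  have hE' : ∫ x, ρ x = 1 := hE
  have hQ' : ∫ x, κ x = M := hQ
  -- The intermediate value theorem for the primitive of the energy density, whose limits at the two
  -- ends differ by `1`.
  obtain ⟨c, hc⟩ : ∃ c, ∫ x in Iic c, ρ x = 1 / 2 := by
    have h1 := intervalIntegral.integral_Iic_add_Ioi (b := 0) hi.integrableOn hi.integrableOn
    have t1 := intervalIntegral_tendsto_integral_Ioi 0 hi.integrableOn tendsto_id
    have t2 := (intervalIntegral_tendsto_integral_Iic 0 hi.integrableOn tendsto_id).neg
    simp only [id_eq, ← intervalIntegral.integral_symm] at t1 t2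
    obtain ⟨c, hc⟩ := mem_range_of_exists_le_of_exists_ge
      (c := 1 / 2 - ∫ x in Iic 0, ρ x) (f := fun c => ∫ x in (0:ℝ)..c, ρ x)
      (intervalIntegral.continuous_primitive (fun _ _ => hi.intervalIntegrable) 0)
      (((t2.eventually_lt_const (by linarith)).exists).imp fun _ h => h.le)
      (((t1.eventually_const_lt (by linarith)).exists).imp fun _ h => h.le)
    refine ⟨c, ?_⟩
    have := intervalIntegral.integral_Iic_sub_Iic (a := 0) (b := c) hi.integrableOn hi.integrableOn
    simp only at hc
    linarith
  have h1 := intervalIntegral.integral_Iic_add_Ioi (b := c) hi.integrableOn hi.integrableOn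
  have h2 := intervalIntegral.integral_Iic_add_Ioi (b := c) hq.integrableOn hq.integrableOn
  have tr : ∀ (f : ℝ → ℝ), ∫ x in Ioi 0, f (x + c) = ∫ x in Ioi c, f x := fun f => by
    have := (measurePreserving_add_right volume c).setIntegral_preimage_emb
      (measurableEmbedding_addRight c) f (Ioi c)
    simpa using this
  have tl : ∀ (f : ℝ → ℝ), ∫ x in Ioi 0, f (-x + c) = ∫ x in Iic c, f x := fun f => by
    have := (measurePreserving_add_right volume c).setIntegral_preimage_emb
      (measurableEmbedding_addRight c) f (Iic c)
    rw [integral_comp_neg_Ioi 0 (fun x => f (x + c))]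
    simpa using this
  rcases le_total (∫ x in Iic c, κ x) (∫ x in Ioi c, κ x) with h | h
  · refine half (hu.comp_add_right c) (hv.comp_add_right c) (fun x => hu0 _) (fun x => hv0 _) ?_ ?_
    · rw [tr ρ]; linarith
    · rw [tr κ]; linarith
  · refine half (hu.comp_add_right c).comp_neg (hv.comp_add_right c).comp_neg
      (fun x => hu0 _) (fun x => hv0 _) ?_ ?_
    · simp only [neg_sq]
      rw [tl ρ]; linarith
    · rw [tl κ]; linarith

end Maximizer

/-! ### The complex functionals, scaling and the supremum -/

section Functionals

theorem IsH1.of_contDiff {φ : ℝ → ℝ} (hφ : ContDiff ℝ (⊤ : ℕ∞) φ) (hc : HasCompactSupport φ) :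
    IsH1 φ (deriv φ) := by
  have hd : Continuous (deriv φ) := hφ.continuous_deriv (by simp)
  refine ⟨hφ.continuous.memLp_of_hasCompactSupport hc, hd.memLp_of_hasCompactSupport hc.deriv,
    fun x y => ?_⟩
  rw [intervalIntegral.integral_deriv_eq_sub (fun t _ => hφ.differentiable (by simp) t)
    (hd.intervalIntegrable _ _)]

theorem norm_sq_add_mul_I (p q : ℝ) : ‖(p + q * Complex.I : ℂ)‖ ^ 2 = p ^ 2 + q ^ 2 := by
  rw [Complex.sq_norm, Complex.normSq_apply]
  simp; ring

theorem J_density_eq (p q r s : ℝ) :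
    3 * (‖(p + q * Complex.I : ℂ)‖ ^ 4 + ‖(r + s * Complex.I : ℂ)‖ ^ 4
      + 4 * ‖(p + q * Complex.I : ℂ)‖ ^ 2 * ‖(r + s * Complex.I : ℂ)‖ ^ 2)
      + 4 * ((starRingEnd ℂ (p + q * Complex.I)) ^ 3 * (r + s * Complex.I)).re
    = 3 * ((p ^ 2 + q ^ 2) ^ 2 + (r ^ 2 + s ^ 2) ^ 2 + 4 * (p ^ 2 + q ^ 2) * (r ^ 2 + s ^ 2))
      + 4 * ((p ^ 3 - 3 * p * q ^ 2) * r + (3 * p ^ 2 * q - q ^ 3) * s) := by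
  have h4 : ∀ z : ℂ, ‖z‖ ^ 4 = (‖z‖ ^ 2) ^ 2 := fun z => by ring
  rw [h4, h4, norm_sq_add_mul_I, norm_sq_add_mul_I]
  congr 2
  simp [pow_succ]
  ring

theorem J_toC (u v : ℝ → ℝ) : J (toC u) (toC v) = quartic u v := by
  refine integral_congr_ae (ae_of_all _ fun x => ?_)
  have := J_density_eq (u x) 0 (v x) 0
  simp only [Complex.ofReal_zero, zero_mul, add_zero] at this
  simp only [toC]
  rw [this]
  ring

variable {ω : ℝ} {u v F F' G G' : ℝ → ℂ}

theorem J_congr (hu : u =ᵐ[volume] F) (hv : v =ᵐ[volume] G) : J u v = J F G := by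
  refine integral_congr_ae ?_
  filter_upwards [hu, hv] with x h1 h2
  rw [h1, h2]

theorem I_eq (hF : IsH1 F F') (hG : IsH1 G G') (hu : u =ᵐ[volume] F) (hv : v =ᵐ[volume] G) :
    I ω u v = ∫ x, (‖F' x‖ ^ 2 + ‖G' x‖ ^ 2 + (4 - ω ^ 2) * ‖F x‖ ^ 2
      + (4 - 9 * ω ^ 2) * ‖G x‖ ^ 2) := by
  refine integral_congr_ae ?_
  filter_upwards [hu, hv, hF.weakDeriv_ae_eq hu, hG.weakDeriv_ae_eq hv] with x h1 h2 h3 h4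
  rw [h1, h2, h3, h4]

theorem I_toC {u u' v v' : ℝ → ℝ} (hu : IsH1 u u') (hv : IsH1 v v') :
    I ω (toC u) (toC v) = energy (4 - ω ^ 2) (4 - 9 * ω ^ 2) u u' v v' := by
  have := I_eq (ω := ω) (u := toC u) (v := toC v) hu.ofReal hv.ofReal (ae_eq_refl _) (ae_eq_refl _)
  rw [this]
  simp only [Complex.norm_real, Real.norm_eq_abs, sq_abs, energy]

theorem quartic_nonneg {u v : ℝ → ℝ} (hu : ∀ x, 0 ≤ u x) (hv : ∀ x, 0 ≤ v x) :
    0 ≤ quartic u v :=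
  integral_nonneg fun x => by have := hu x; have := hv x; positivity

/-- Taking moduli lowers `I` and raises `J`. -/
theorem exists_nonneg_pair (ω : ℝ) (hu : MemH1 u)
    (hv : MemH1 v) :
    ∃ p p' q q' : ℝ → ℝ, IsH1 p p' ∧ IsH1 q q' ∧ (∀ x, 0 ≤ p x) ∧ (∀ x, 0 ≤ q x) ∧
      energy (4 - ω ^ 2) (4 - 9 * ω ^ 2) p p' q q' ≤ I ω u v ∧ J u v ≤ quartic p q := by
  obtain ⟨F, hF, hF'⟩ := hu.exists_isH1
  obtain ⟨G, hG, hG'⟩ := hv.exists_isH1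
  obtain ⟨p', hp, hp'⟩ := hF'.norm
  obtain ⟨q', hq, hq'⟩ := hG'.norm
  refine ⟨_, p', _, q', hp, hq, fun x => norm_nonneg _, fun x => norm_nonneg _, ?_, ?_⟩
  · rw [I_eq hF' hG' hF hG]
    refine integral_mono_ae (integrable_energy hp hq _ _) ?_ ?_
    · exact ((hF'.memLp_deriv.norm.integrable_sq.add hG'.memLp_deriv.norm.integrable_sq).add
        (hF'.memLp.norm.integrable_sq.const_mul _)).add
        (hG'.memLp.norm.integrable_sq.const_mul _)
    · filter_upwards [hp', hq'] with x h1 h2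
      have h3 := pow_le_pow_left₀ (abs_nonneg _) h1 2
      have h4 := pow_le_pow_left₀ (abs_nonneg _) h2 2
      rw [sq_abs] at h3 h4
      linarith
  · rw [J_congr hF hG]
    by_cases hi : Integrable fun x => (3 * (‖F x‖ ^ 4 + ‖G x‖ ^ 4 + 4 * ‖F x‖ ^ 2 * ‖G x‖ ^ 2)
      + 4 * ((starRingEnd ℂ (F x)) ^ 3 * G x).re)
    · refine integral_mono hi (integrable_quartic hp.l2Bdd hq.l2Bdd) fun x => ?_
      have : ((starRingEnd ℂ (F x)) ^ 3 * G x).re ≤ ‖F x‖ ^ 3 * ‖G x‖ := by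
        refine (Complex.re_le_norm _).trans_eq ?_
        rw [norm_mul, norm_pow, RCLike.norm_conj]
      simp only
      linarith
    -- A non-integrable density would make `J` equal to `0` by convention, which the nonnegative
    -- quartic value still dominates.
    · rw [J, integral_undef hi]
      exact quartic_nonneg (fun x => norm_nonneg _) fun x => norm_nonneg _

theorem exists_J_le (ha : 0 < 4 - ω ^ 2) (hb : 0 < 4 - 9 * ω ^ 2) :
    ∃ K, ∀ {u v : ℝ → ℂ}, MemH1 u → MemH1 v → J u v ≤ K * I ω u v ^ 2 := by
  refine ⟨7 * (2 * (1 / (4 - ω ^ 2) + 1 / (4 - 9 * ω ^ 2) + 2))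
    * (1 / (4 - ω ^ 2) + 1 / (4 - 9 * ω ^ 2)), fun hu hv => ?_⟩
  obtain ⟨p, p', q, q', hp, hq, -, -, hE, hJ⟩ := exists_nonneg_pair ω hu hv
  refine (hJ.trans (quartic_le_mul_energy_sq ha hb hp hq)).trans ?_
  have h0 := energy_nonneg (u := p) (u' := p') (v := q) (v' := q') ha.le hb.le
  gcongr

theorem bddAbove_values (ha : 0 < 4 - ω ^ 2) (hb : 0 < 4 - 9 * ω ^ 2) : BddAbove (values ω) := by
  obtain ⟨K, hK⟩ := exists_J_le ha hb
  refine ⟨K, ?_⟩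
  rintro _ ⟨w, ⟨h1, h2, h3⟩, rfl⟩
  simpa [h3] using hK h1 h2

theorem J_const_smul (c : ℝ) (u v : ℝ → ℂ) :
    J (fun x => c • u x) (fun x => c • v x) = c ^ 4 * J u v := by
  rw [J, J, ← integral_const_mul]
  refine integral_congr_ae (ae_of_all _ fun x => ?_)
  have h : (starRingEnd ℂ (c • u x)) ^ 3 * (c • v x)
      = (c ^ 4 : ℝ) • ((starRingEnd ℂ (u x)) ^ 3 * v x) := by
    simp only [Complex.real_smul, map_mul, Complex.conj_ofReal]
    push_cast; ring
  simp only
  rw [h, Complex.smul_re, smul_eq_mul, norm_smul, norm_smul, Real.norm_eq_abs]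
  have h2 := sq_abs c
  have h4 : |c| ^ 4 = c ^ 4 := by rw [← abs_pow]; exact abs_of_nonneg (by positivity)
  simp only [mul_pow, h2, h4]
  ring

theorem I_const_smul (c : ℝ) (hu : MemH1 u) (hv : MemH1 v) :
    MemH1 (fun x => c • u x) ∧ MemH1 (fun x => c • v x) ∧
    I ω (fun x => c • u x) (fun x => c • v x) = c ^ 2 * I ω u v := by
  obtain ⟨F, hF, hF'⟩ := hu.exists_isH1
  obtain ⟨G, hG, hG'⟩ := hv.exists_isH1
  have e1 : (fun x => c • u x) =ᵐ[volume] fun x => c • F x := hF.mono fun x hx => by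
    simp only [hx]
  have e2 : (fun x => c • v x) =ᵐ[volume] fun x => c • G x := hG.mono fun x hx => by
    simp only [hx]
  refine ⟨(hF'.const_smul c).memH1_of_ae_eq e1, (hG'.const_smul c).memH1_of_ae_eq e2, ?_⟩
  rw [I_eq (hF'.const_smul c) (hG'.const_smul c) e1 e2, I_eq hF' hG' hF hG, ← integral_const_mul]
  refine integral_congr_ae (ae_of_all _ fun x => ?_)
  simp only [norm_smul, Real.norm_eq_abs, mul_pow, sq_abs]
  ring

theorem I_nonneg (ha : 0 ≤ 4 - ω ^ 2) (hb : 0 ≤ 4 - 9 * ω ^ 2) : 0 ≤ I ω u v :=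
  integral_nonneg fun x => by positivity

/-- Scaling by `I ^ (-1/2)` makes a pair admissible. When `I = 0` no scaling exists, and the crude
bound `exists_J_le` gives `J ≤ 0`. -/
theorem J_le_sSup_mul (ha : 0 < 4 - ω ^ 2) (hb : 0 < 4 - 9 * ω ^ 2) (hu : MemH1 u)
    (hv : MemH1 v) : J u v ≤ sSup (values ω) * I ω u v ^ 2 := by
  rcases (I_nonneg (u := u) (v := v) ha.le hb.le).eq_or_lt with h0 | h0
  · obtain ⟨K, hK⟩ := exists_J_le ha hb
    simpa [← h0] using hK hu hv
  · set c := (√(I ω u v))⁻¹ with hc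
    have hc2 : c ^ 2 * I ω u v = 1 := by
      rw [hc, inv_pow, Real.sq_sqrt h0.le, inv_mul_cancel₀ h0.ne']
    obtain ⟨h1, h2, h3⟩ := I_const_smul (ω := ω) c hu hv
    have h4 : c ^ 4 * J u v ≤ sSup (values ω) := by
      rw [← J_const_smul]
      exact le_csSup (bddAbove_values ha hb) ⟨(_, _), ⟨h1, h2, h3.trans hc2⟩, rfl⟩
    calc J u v = (c ^ 4 * J u v) * I ω u v ^ 2 := by
          linear_combination (-(c ^ 2 * I ω u v) - 1) * J u v * hc2
      _ ≤ _ := by gcongr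

/-- A pair `(0, η)` with `η` a bump has `J > 0`, and `J ≤ sSup * I ^ 2` then forces a positive
supremum. -/
theorem sSup_values_pos (ha : 0 < 4 - ω ^ 2) (hb : 0 < 4 - 9 * ω ^ 2) : 0 < sSup (values ω) := by
  let η : ContDiffBump (0 : ℝ) := ⟨1, 2, by norm_num, by norm_num⟩
  have h : IsH1 η (deriv η) := IsH1.of_contDiff η.contDiff η.hasCompactSupport
  have hz : IsH1 (fun _ : ℝ => (0 : ℝ)) (fun _ => 0) := IsH1.zero
  have hJ := J_le_sSup_mul ha hb (hz.ofReal.memH1_of_ae_eq (ae_eq_refl _))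
    (h.ofReal.memH1_of_ae_eq (ae_eq_refl _))
  have hpos : 0 < J (toC fun _ => 0) (toC η) := by
    rw [J_toC, quartic, integral_pos_iff_support_of_nonneg
      (fun x => by have := η.nonneg (x := x); positivity)
      (integrable_quartic hz.l2Bdd h.l2Bdd)]
    refine lt_of_lt_of_le ?_ (measure_mono (s := Metric.ball (0 : ℝ) 1) fun x hx => ?_)
    · simp
    · rw [Function.mem_support, η.one_of_mem_closedBall (Metric.ball_subset_closedBall hx)]
      norm_num
  by_contra! hcon
  have := mul_nonpos_of_nonpos_of_nonneg hcon (sq_nonneg (I ω (toC fun _ => 0) (toC η)))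
  exact absurd (hpos.trans_le hJ) (not_lt.mpr this)

theorem quartic_le_sSup_mul (ha : 0 < 4 - ω ^ 2) (hb : 0 < 4 - 9 * ω ^ 2) {u u' v v' : ℝ → ℝ}
    (hu : IsH1 u u') (hv : IsH1 v v') : quartic u v
      ≤ sSup (values ω) * energy (4 - ω ^ 2) (4 - 9 * ω ^ 2) u u' v v' ^ 2 := by
  rw [← J_toC, ← I_toC hu hv]
  exact J_le_sSup_mul ha hb (hu.ofReal.memH1_of_ae_eq (ae_eq_refl _))
    (hv.ofReal.memH1_of_ae_eq (ae_eq_refl _))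

theorem exists_even_nonneg_maximizer (ha : 0 < 4 - ω ^ 2) (hb : 0 < 4 - 9 * ω ^ 2) :
    ∃ u u' v v' : ℝ → ℝ, IsH1 u u' ∧ IsH1 v v' ∧ (∀ x, 0 ≤ u x) ∧
      (∀ x, 0 ≤ v x) ∧ energy (4 - ω ^ 2) (4 - 9 * ω ^ 2) u u' v v' = 1 ∧
      quartic u v = sSup (values ω) ∧ Function.Even u ∧ Function.Even v := by
  have hM := fun {u u' v v' : ℝ → ℝ} (hu : IsH1 u u') (hv : IsH1 v v') =>
    quartic_le_sSup_mul ha hb hu hv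
  refine exists_even_maximizer hM (exists_maximizer ha hb (sSup_values_pos ha hb) hM ?_)
  intro ε hε
  -- The real supremum of the empty set is `0` by convention, which positivity excludes.
  have hne : (values ω).Nonempty := by
    by_contra hcon
    have := sSup_values_pos ha hb
    rw [Set.not_nonempty_iff_eq_empty.mp hcon, Real.sSup_empty] at this
    exact this.false
  obtain ⟨_, ⟨w, ⟨h1, h2, h3⟩, rfl⟩, hw⟩ := exists_lt_of_lt_csSup hne (sub_lt_self _ hε)
  obtain ⟨p, p', q, q', hp, hq, hp0, hq0, hE, hJ⟩ := exists_nonneg_pair ω h1 h2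
  exact ⟨p, p', q, q', hp, hq, hp0, hq0, hE.trans_eq h3, hw.le.trans hJ⟩

end Functionals

/-- Divide by `t` and let `t → 0` from both sides, then divide by `t ^ 2`. -/
theorem eq_zero_and_nonneg_of_forall_poly_nonneg {A B C D : ℝ}
    (h : ∀ t : ℝ, 0 ≤ t * A + t ^ 2 * B + t ^ 3 * C + t ^ 4 * D) : A = 0 ∧ 0 ≤ B := by
  have lim : ∀ a b c d : ℝ, (∀ t : ℝ, 0 < t → 0 ≤ a + t * b + t ^ 2 * c + t ^ 3 * d) → 0 ≤ a := by
    intro a b c d hp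
    have hc : Tendsto (fun t : ℝ => a + t * b + t ^ 2 * c + t ^ 3 * d) (𝓝[>] 0)
        (𝓝 (a + 0 * b + 0 ^ 2 * c + 0 ^ 3 * d)) :=
      (Continuous.tendsto (by fun_prop) 0).mono_left nhdsWithin_le_nhds
    have := ge_of_tendsto hc (eventually_mem_nhdsWithin.mono fun t ht => hp t ht)
    simpa using this
  have h1 : 0 ≤ A := lim A B C D fun t ht => by
    refine nonneg_of_mul_nonneg_right (a := t) ?_ ht
    linarith [h t]
  have h2 : 0 ≤ -A := lim (-A) B (-C) D fun t ht => by
    refine nonneg_of_mul_nonneg_right (a := t) ?_ ht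
    linarith [h (-t)]
  have h3 : A = 0 := by linarith
  refine ⟨h3, lim B C D 0 fun t ht => ?_⟩
  have := h t
  rw [h3] at this
  refine nonneg_of_mul_nonneg_right (a := t ^ 2) ?_ (by positivity)
  linarith

/-! ### First and second variation -/

section Variation

variable {ω : ℝ} {U U' V V' p p' q q' r r' s s' : ℝ → ℝ}

/-- First and second order conditions at a real maximizer. -/
theorem variation_conditions (ha : 0 < 4 - ω ^ 2) (hb : 0 < 4 - 9 * ω ^ 2)
    (hU : IsH1 U U') (hV : IsH1 V V')
    (hE : energy (4 - ω ^ 2) (4 - 9 * ω ^ 2) U U' V V' = 1) (hQ : quartic U V = sSup (values ω))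
    (hp : IsH1 p p') (hq : IsH1 q q') (hr : IsH1 r r') (hs : IsH1 s s')
    {B E Q : ℝ}
    (hB : B = ∫ x, (U' x * p' x + V' x * r' x + (4 - ω ^ 2) * (U x * p x)
      + (4 - 9 * ω ^ 2) * (V x * r x)))
    (hE2 : E = ∫ x, (p' x ^ 2 + q' x ^ 2 + r' x ^ 2 + s' x ^ 2
      + (4 - ω ^ 2) * (p x ^ 2 + q x ^ 2) + (4 - 9 * ω ^ 2) * (r x ^ 2 + s x ^ 2)))
    (hQ2 : Q = ∫ x, ((18 * U x ^ 2 + 12 * V x ^ 2 + 12 * (U x * V x)) * p x ^ 2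
      + (18 * V x ^ 2 + 12 * U x ^ 2) * r x ^ 2
      + (48 * (U x * V x) + 12 * U x ^ 2) * (p x * r x)
      + (6 * U x ^ 2 + 12 * V x ^ 2 - 12 * (U x * V x)) * q x ^ 2
      + (6 * V x ^ 2 + 12 * U x ^ 2) * s x ^ 2 + 12 * (U x ^ 2 * (q x * s x)))) :
    ∫ x, ((12 * U x ^ 3 + 24 * (V x ^ 2 * U x) + 12 * (U x ^ 2 * V x)) * p x
      + (12 * V x ^ 3 + 24 * (U x ^ 2 * V x) + 4 * U x ^ 3) * r x) = 4 * sSup (values ω) * B ∧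
    Q ≤ sSup (values ω) * (4 * B ^ 2 + 2 * E) := by
  have lU := hU.l2Bdd
  have lV := hV.l2Bdd
  have lp := hp.l2Bdd
  have lq := hq.l2Bdd
  have lr := hr.l2Bdd
  have ls := hs.l2Bdd
  have iJ := integrable_quartic lU lV
  have iE := integrable_energy hU hV (4 - ω ^ 2) (4 - 9 * ω ^ 2)
  have iN : Integrable fun x => (12 * U x ^ 3 + 24 * (V x ^ 2 * U x) + 12 * (U x ^ 2 * V x)) * p x
      + (12 * V x ^ 3 + 24 * (U x ^ 2 * V x) + 4 * U x ^ 3) * r x := by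
    repeat'
      first
        | assumption | apply Integrable.fun_add | apply Integrable.const_mul
        | apply L2Bdd.integrable_mul | apply L2Bdd.sub | apply L2Bdd.add | apply L2Bdd.const_mul
        | apply L2Bdd.mul
  have iQ : Integrable fun x => (18 * U x ^ 2 + 12 * V x ^ 2 + 12 * (U x * V x)) * p x ^ 2
      + (18 * V x ^ 2 + 12 * U x ^ 2) * r x ^ 2
      + (48 * (U x * V x) + 12 * U x ^ 2) * (p x * r x)
      + (6 * U x ^ 2 + 12 * V x ^ 2 - 12 * (U x * V x)) * q x ^ 2
      + (6 * V x ^ 2 + 12 * U x ^ 2) * s x ^ 2 + 12 * (U x ^ 2 * (q x * s x)) := by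
    repeat'
      first
        | assumption | apply Integrable.fun_add | apply Integrable.const_mul
        | apply L2Bdd.integrable_mul | apply L2Bdd.sub | apply L2Bdd.add | apply L2Bdd.const_mul
        | apply L2Bdd.mul
  -- `c3` and `c4` are the coefficients of `t ^ 3` and `t ^ 4` in the density of `J`; only their
  -- integrability matters.
  set c3 : ℝ → ℝ := fun x => 12 * ((U x * p x) * (p x ^ 2 + q x ^ 2))
    + 12 * ((V x * r x) * (r x ^ 2 + s x ^ 2)) + 24 * ((U x * p x) * (r x ^ 2 + s x ^ 2))
    + 24 * ((V x * r x) * (p x ^ 2 + q x ^ 2)) + 4 * ((p x ^ 3 - 3 * (p x * q x ^ 2)) * V x)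
    + 12 * ((U x * r x) * (p x ^ 2 - q x ^ 2)) + 24 * ((U x * p x) * (q x * s x)) with hc3
  have i3 : Integrable c3 := by
    rw [hc3]
    repeat'
      first
        | assumption | apply Integrable.fun_add | apply Integrable.const_mul
        | apply L2Bdd.integrable_mul | apply L2Bdd.sub | apply L2Bdd.add | apply L2Bdd.const_mul
        | apply L2Bdd.mul
  set c4 : ℝ → ℝ := fun x => 3 * ((p x ^ 2 + q x ^ 2) * (p x ^ 2 + q x ^ 2))
    + 3 * ((r x ^ 2 + s x ^ 2) * (r x ^ 2 + s x ^ 2))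
    + 12 * ((p x ^ 2 + q x ^ 2) * (r x ^ 2 + s x ^ 2))
    + 4 * ((p x ^ 3 - 3 * (p x * q x ^ 2)) * r x)
    + 4 * ((3 * (p x ^ 2 * q x) - q x ^ 3) * s x) with hc4
  have i4 : Integrable c4 := by
    rw [hc4]
    repeat'
      first
        | assumption | apply Integrable.fun_add | apply Integrable.const_mul
        | apply L2Bdd.integrable_mul | apply L2Bdd.sub | apply L2Bdd.add | apply L2Bdd.const_mul
        | apply L2Bdd.mul
  have iB : Integrable fun x => U' x * p' x + V' x * r' x + (4 - ω ^ 2) * (U x * p x)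
      + (4 - 9 * ω ^ 2) * (V x * r x) :=
    (((hU.memLp_deriv.integrable_mul hp.memLp_deriv).add
      (hV.memLp_deriv.integrable_mul hr.memLp_deriv)).add
      ((lU.integrable_mul lp).const_mul _)).add ((lV.integrable_mul lr).const_mul _)
  have iE2 : Integrable fun x => p' x ^ 2 + q' x ^ 2 + r' x ^ 2 + s' x ^ 2
      + (4 - ω ^ 2) * (p x ^ 2 + q x ^ 2) + (4 - 9 * ω ^ 2) * (r x ^ 2 + s x ^ 2) :=
    ((((hp.integrable_deriv_sq.add hq.integrable_deriv_sq).add hr.integrable_deriv_sq).add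
      hs.integrable_deriv_sq).add ((hp.integrable_sq.add hq.integrable_sq).const_mul _)).add
      ((hr.integrable_sq.add hs.integrable_sq).const_mul _)
  set N := ∫ x, ((12 * U x ^ 3 + 24 * (V x ^ 2 * U x) + 12 * (U x ^ 2 * V x)) * p x
      + (12 * V x ^ 3 + 24 * (U x ^ 2 * V x) + 4 * U x ^ 3) * r x) with hN
  set M := sSup (values ω) with hM
  -- This is `J ≤ M * I ^ 2` along the complex line through `(U, V)`. The imaginary parts `q, s`
  -- enter only from second order on, since `U, V` are real.
  have poly : ∀ t : ℝ, M + t * N + t ^ 2 * Q + t ^ 3 * (∫ x, c3 x) + t ^ 4 * (∫ x, c4 x)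
      ≤ M * (1 + 2 * t * B + t ^ 2 * E) ^ 2 := fun t => by
    have hu := (hU.add (hp.const_mul t)).complex (hq.const_mul t)
    have hv := (hV.add (hr.const_mul t)).complex (hs.const_mul t)
    have key := J_le_sSup_mul ha hb (hu.memH1_of_ae_eq (ae_eq_refl _))
      (hv.memH1_of_ae_eq (ae_eq_refl _))
    rw [I_eq hu hv (ae_eq_refl _) (ae_eq_refl _)] at key
    simp only [J, J_density_eq] at key
    simp only [norm_sq_add_mul_I] at key
    convert key using 1
    · rw [← hQ, quartic, hN, hQ2, ← integral_const_mul, ← integral_const_mul,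
        ← integral_const_mul, ← integral_const_mul, ← integral_add iJ (iN.const_mul t),
        ← integral_add (iJ.fun_add (iN.const_mul t)) (iQ.const_mul _),
        ← integral_add ((iJ.fun_add (iN.const_mul t)).fun_add (iQ.const_mul _)) (i3.const_mul _),
        ← integral_add (((iJ.fun_add (iN.const_mul t)).fun_add (iQ.const_mul _)).fun_add
          (i3.const_mul _)) (i4.const_mul _)]
      refine integral_congr_ae (ae_of_all _ fun x => ?_)
      simp only [hc3, hc4]
      ring
    · congr 2
      rw [← hE, energy, hB, hE2, ← integral_const_mul, ← integral_const_mul,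
        ← integral_add iE (iB.const_mul _),
        ← integral_add (iE.fun_add (iB.const_mul _)) (iE2.const_mul _)]
      refine integral_congr_ae (ae_of_all _ fun x => ?_)
      simp only
      ring
  obtain ⟨h1, h2⟩ := eq_zero_and_nonneg_of_forall_poly_nonneg (A := 4 * M * B - N)
    (B := M * (4 * B ^ 2 + 2 * E) - Q) (C := M * (4 * B * E) - ∫ x, c3 x)
    (D := M * E ^ 2 - ∫ x, c4 x) fun t => by
      have := poly t
      linarith
  exact ⟨by linarith, by linarith⟩

end Variation

/-! ### Regularity by bootstrapping -/

section Regularity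

theorem IsH1.hasDerivAt {f g : ℝ → ℝ} (h : IsH1 f g) (hg : Continuous g) (x : ℝ) :
    HasDerivAt f (g x) x := by
  have : f = fun y => f 0 + ∫ t in (0 : ℝ)..y, g t := by
    ext y; rw [← h.sub_eq]; ring
  rw [this]
  exact ((hg.integral_hasStrictDerivAt 0 x).hasDerivAt).const_add _

theorem contDiff_nat_succ_of_hasDerivAt {n : ℕ} {f g : ℝ → ℝ} (h : ∀ x, HasDerivAt f (g x) x)
    (hg : ContDiff ℝ n g) : ContDiff ℝ (n + 1 : ℕ) f := by
  have hd : deriv f = g := funext fun x => (h x).deriv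
  push_cast
  rw [contDiff_succ_iff_deriv]
  exact ⟨fun x => (h x).differentiableAt, by simp, hd ▸ hg⟩

/-- Solutions of second order systems with smooth nonlinearity are smooth. -/
theorem contDiff_of_second_order_system {U U' V V' : ℝ → ℝ} {P Q : ℝ × ℝ → ℝ}
    (hP : ContDiff ℝ (⊤ : ℕ∞) P) (hQ : ContDiff ℝ (⊤ : ℕ∞) Q)
    (hU : ∀ x, HasDerivAt U (U' x) x) (hU' : ∀ x, HasDerivAt U' (P (U x, V x)) x)
    (hV : ∀ x, HasDerivAt V (V' x) x) (hV' : ∀ x, HasDerivAt V' (Q (U x, V x)) x) :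
    ContDiff ℝ (⊤ : ℕ∞) U ∧ ContDiff ℝ (⊤ : ℕ∞) V := by
  have key : ∀ n : ℕ, ContDiff ℝ n U ∧ ContDiff ℝ n V := by
    intro n
    induction n with
    | zero =>
      simp only [Nat.cast_zero, contDiff_zero]
      exact ⟨continuous_iff_continuousAt.mpr fun x => (hU x).continuousAt,
        continuous_iff_continuousAt.mpr fun x => (hV x).continuousAt⟩
    | succ n ih =>
      have hn : (n : WithTop ℕ∞) ≤ (n + 1 : ℕ) := by exact_mod_cast n.le_succ
      have hle : (n : WithTop ℕ∞) ≤ ((⊤ : ℕ∞) : WithTop ℕ∞) := by exact_mod_cast le_top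
      have h1 := contDiff_nat_succ_of_hasDerivAt hU' ((hP.of_le hle).comp (ih.1.prodMk ih.2))
      have h2 := contDiff_nat_succ_of_hasDerivAt hV' ((hQ.of_le hle).comp (ih.1.prodMk ih.2))
      exact ⟨contDiff_nat_succ_of_hasDerivAt hU (h1.of_le hn),
        contDiff_nat_succ_of_hasDerivAt hV (h2.of_le hn)⟩
  exact ⟨contDiff_infty.mpr fun n => (key n).1, contDiff_infty.mpr fun n => (key n).2⟩

end Regularity

/-! ### Weak Euler–Lagrange system -/

section EulerLagrange

variable {ω : ℝ} {U U' V V' : ℝ → ℝ}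

/-- The Euler–Lagrange system of a real maximizer, in the weak sense. -/
theorem hasWeakDeriv_of_maximizer (ha : 0 < 4 - ω ^ 2) (hb : 0 < 4 - 9 * ω ^ 2)
    (hU : IsH1 U U') (hV : IsH1 V V')
    (hE : energy (4 - ω ^ 2) (4 - 9 * ω ^ 2) U U' V V' = 1) (hQ : quartic U V = sSup (values ω))
    {J₀ : ℝ} (hJ₀ : J₀ = 2 * sSup (values ω)) :
    HasWeakDeriv U' (fun x => (4 - ω ^ 2) * U x
      - 1 / J₀ * (6 * U x ^ 3 + 12 * (V x ^ 2 * U x) + 6 * (U x ^ 2 * V x))) ∧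
    HasWeakDeriv V' (fun x => (4 - 9 * ω ^ 2) * V x
      - 1 / J₀ * (6 * V x ^ 3 + 12 * (U x ^ 2 * V x) + 2 * U x ^ 3)) := by
  have lU := hU.l2Bdd
  have lV := hV.l2Bdd
  have hM := sSup_values_pos ha hb
  have hz : IsH1 (fun _ : ℝ => (0 : ℝ)) (fun _ => 0) := IsH1.zero
  have cU := hU.continuous
  have cV := hV.continuous
  -- Varying one real component at a time gives a first-order identity of this shape; dividing by `4
  -- * sSup (values ω) = 2 * J₀` turns it into the definition of a weak derivative.
  have weak : ∀ {k f g P : ℝ → ℝ} (c : ℝ), LocallyIntegrable k → Continuous f → Continuous g →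
      P = (fun x => c * f x - 1 / J₀ * g x) →
      (∀ φ : ℝ → ℝ, ContDiff ℝ (⊤ : ℕ∞) φ → HasCompactSupport φ →
        ∫ x, 2 * g x * φ x = 4 * sSup (values ω) * ∫ x, (k x * deriv φ x + c * (f x * φ x))) →
      HasWeakDeriv k P := by
    rintro k f g P c hk hf hg rfl h
    refine ⟨hk, Continuous.locallyIntegrable (by fun_prop), fun φ hφ hφc => ?_⟩
    have h1 := h φ hφ hφc
    have hφ0 := hφ.continuous
    have i1 : Integrable fun x => k x * deriv φ x := by
      simpa only [smul_eq_mul, mul_comm] using hk.integrable_smul_left_of_hasCompactSupport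
        (hφ.continuous_deriv (by simp)) hφc.deriv
    have i2 : Integrable fun x => f x * φ x :=
      (hf.mul hφ0).integrable_of_hasCompactSupport hφc.mul_left
    have i3 : Integrable fun x => g x * φ x :=
      (hg.mul hφ0).integrable_of_hasCompactSupport hφc.mul_left
    simp_rw [mul_assoc (2 : ℝ)] at h1
    rw [integral_const_mul, integral_add i1 (i2.const_mul c), integral_const_mul] at h1
    have e : ∀ x, φ x • (c * f x - 1 / J₀ * g x) = c * (f x * φ x) - 1 / J₀ * (g x * φ x) :=
      fun x => by simp only [smul_eq_mul]; ring
    simp_rw [e]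
    rw [integral_sub (i2.const_mul c) (i3.const_mul _), integral_const_mul, integral_const_mul]
    have e2 : ∫ x, deriv φ x • k x = ∫ x, k x * deriv φ x := by
      simp only [smul_eq_mul, mul_comm]
    rw [e2, hJ₀]
    field_simp
    linarith
  constructor
  · refine weak _ hU.locallyIntegrable_deriv cU (by fun_prop) rfl fun φ hφ hφc => ?_
    have h := (variation_conditions ha hb hU hV hE hQ (IsH1.of_contDiff hφ hφc) hz hz hz
      rfl rfl rfl).1
    simp only [mul_zero, add_zero] at h
    rw [← h]
    exact integral_congr_ae (ae_of_all _ fun x => by simp only; ring)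
  · refine weak _ hV.locallyIntegrable_deriv cV (by fun_prop) rfl fun φ hφ hφc => ?_
    have h := (variation_conditions ha hb hU hV hE hQ hz hz (IsH1.of_contDiff hφ hφc) hz
      rfl rfl rfl).1
    simp only [mul_zero, add_zero, zero_add] at h
    rw [← h]
    exact integral_congr_ae (ae_of_all _ fun x => by simp only; ring)

end EulerLagrange

theorem MemH2.exists_isH1 {h : ℝ → ℝ} (hh : MemH2 h) :
    ∃ F G, h =ᵐ[volume] F ∧ IsH1 F G ∧ IsH1 G (weakDeriv (weakDeriv h)) := by
  obtain ⟨F, hF, hF'⟩ := hh.1.exists_isH1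
  obtain ⟨G, hG, hG'⟩ := hh.2.exists_isH1
  exact ⟨F, G, hF, hF'.congr_deriv hG, hG'⟩

/-! ### The quadratic form of the linearized operator -/

section Linearization

variable {ω J₀ : ℝ} {U V : ℝ → ℝ} {h F G : Fin 4 → ℝ → ℝ}

theorem linOp_ae_eq (hF : ∀ i, h i =ᵐ[volume] F i) :
    ∀ᵐ x,
      linOp ω J₀ U V h 0 x = -weakDeriv (weakDeriv (h 0)) x + ((4 - ω ^ 2) * F 0 x
        - (18 / J₀ * U x ^ 2 + 12 / J₀ * V x ^ 2 + 12 / J₀ * (U x * V x)) * F 0 x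
        - (24 / J₀ * (U x * V x) + 6 / J₀ * U x ^ 2) * F 2 x) ∧
      linOp ω J₀ U V h 1 x = -weakDeriv (weakDeriv (h 1)) x + ((4 - ω ^ 2) * F 1 x
        - (6 / J₀ * U x ^ 2 + 12 / J₀ * V x ^ 2 - 12 / J₀ * (U x * V x)) * F 1 x
        - (6 / J₀ * U x ^ 2) * F 3 x) ∧
      linOp ω J₀ U V h 2 x = -weakDeriv (weakDeriv (h 2)) x + ((4 - 9 * ω ^ 2) * F 2 x
        - (18 / J₀ * V x ^ 2 + 12 / J₀ * U x ^ 2) * F 2 x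
        - (24 / J₀ * (U x * V x) + 6 / J₀ * U x ^ 2) * F 0 x) ∧
      linOp ω J₀ U V h 3 x = -weakDeriv (weakDeriv (h 3)) x + ((4 - 9 * ω ^ 2) * F 3 x
        - (6 / J₀ * V x ^ 2 + 12 / J₀ * U x ^ 2) * F 3 x
        - (6 / J₀ * U x ^ 2) * F 1 x) := by
  filter_upwards [hF 0, hF 1, hF 2, hF 3] with x h0 h1 h2 h3
  rw [← h0, ← h1, ← h2, ← h3]
  refine ⟨?_, ?_, ?_, ?_⟩ <;> simp only [linOp, Matrix.cons_val] <;> ring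

theorem memLp_linOp (hU : L2Bdd U) (hV : L2Bdd V) (hF : ∀ i, h i =ᵐ[volume] F i)
    (hFG : ∀ i, IsH1 (F i) (G i)) (hG : ∀ i, IsH1 (G i) (weakDeriv (weakDeriv (h i)))) (i : Fin 4) :
    MemLp (linOp ω J₀ U V h i) 2 := by
  have l0 := (hFG 0).l2Bdd
  have l1 := (hFG 1).l2Bdd
  have l2 := (hFG 2).l2Bdd
  have l3 := (hFG 3).l2Bdd
  have key : ∀ {i : Fin 4} {P : ℝ → ℝ}, L2Bdd P →
      (∀ᵐ x, linOp ω J₀ U V h i x = -weakDeriv (weakDeriv (h i)) x + P x) →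
      MemLp (linOp ω J₀ U V h i) 2 := fun {i P} hP he =>
    (memLp_congr_ae he).mpr ((hG i).memLp_deriv.neg.add hP.memLp)
  have hl := linOp_ae_eq (ω := ω) (J₀ := J₀) (U := U) (V := V) hF
  fin_cases i
  · refine key ?_ (hl.mono fun x hx => hx.1)
    repeat'
      first
        | assumption | apply L2Bdd.sub | apply L2Bdd.add | apply L2Bdd.const_mul | apply L2Bdd.mul
  · refine key ?_ (hl.mono fun x hx => hx.2.1)
    repeat'
      first
        | assumption | apply L2Bdd.sub | apply L2Bdd.add | apply L2Bdd.const_mul | apply L2Bdd.mul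
  · refine key ?_ (hl.mono fun x hx => hx.2.2.1)
    repeat'
      first
        | assumption | apply L2Bdd.sub | apply L2Bdd.add | apply L2Bdd.const_mul | apply L2Bdd.mul
  · refine key ?_ (hl.mono fun x hx => hx.2.2.2)
    repeat'
      first
        | assumption | apply L2Bdd.sub | apply L2Bdd.add | apply L2Bdd.const_mul | apply L2Bdd.mul

/-- The quadratic form of `ℒ`, in terms of the second variations of `I` and `J`. -/
theorem inner4_linOp (hU : L2Bdd U) (hV : L2Bdd V) (hF : ∀ i, h i =ᵐ[volume] F i)
    (hFG : ∀ i, IsH1 (F i) (G i)) (hG : ∀ i, IsH1 (G i) (weakDeriv (weakDeriv (h i)))) :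
    inner4 (linOp ω J₀ U V h) h =
      (∫ x, (G 0 x ^ 2 + G 1 x ^ 2 + G 2 x ^ 2 + G 3 x ^ 2
        + (4 - ω ^ 2) * (F 0 x ^ 2 + F 1 x ^ 2) + (4 - 9 * ω ^ 2) * (F 2 x ^ 2 + F 3 x ^ 2)))
      - 1 / J₀ * ∫ x, ((18 * U x ^ 2 + 12 * V x ^ 2 + 12 * (U x * V x)) * F 0 x ^ 2
        + (18 * V x ^ 2 + 12 * U x ^ 2) * F 2 x ^ 2
        + (48 * (U x * V x) + 12 * U x ^ 2) * (F 0 x * F 2 x)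
        + (6 * U x ^ 2 + 12 * V x ^ 2 - 12 * (U x * V x)) * F 1 x ^ 2
        + (6 * V x ^ 2 + 12 * U x ^ 2) * F 3 x ^ 2 + 12 * (U x ^ 2 * (F 1 x * F 3 x))) := by
  have l0 := (hFG 0).l2Bdd
  have l1 := (hFG 1).l2Bdd
  have l2 := (hFG 2).l2Bdd
  have l3 := (hFG 3).l2Bdd
  have iK : ∀ i, Integrable fun x => weakDeriv (weakDeriv (h i)) x * F i x := fun i =>
    (hG i).memLp_deriv.integrable_mul (hFG i).memLp
  have iG : ∀ i, Integrable fun x => G i x ^ 2 := fun i => (hG i).integrable_sq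
  have hK : ∀ i, ∫ x, weakDeriv (weakDeriv (h i)) x * F i x = -∫ x, G i x ^ 2 := fun i => by
    rw [(hG i).integral_deriv_mul (hFG i)]
    simp only [sq]
  have iD : Integrable fun x => (4 - ω ^ 2) * (F 0 x ^ 2 + F 1 x ^ 2)
      + (4 - 9 * ω ^ 2) * (F 2 x ^ 2 + F 3 x ^ 2) :=
    (((hFG 0).integrable_sq.add (hFG 1).integrable_sq).const_mul _).add
      (((hFG 2).integrable_sq.add (hFG 3).integrable_sq).const_mul _)
  have iQ : Integrable fun x => (18 * U x ^ 2 + 12 * V x ^ 2 + 12 * (U x * V x)) * F 0 x ^ 2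
      + (18 * V x ^ 2 + 12 * U x ^ 2) * F 2 x ^ 2
      + (48 * (U x * V x) + 12 * U x ^ 2) * (F 0 x * F 2 x)
      + (6 * U x ^ 2 + 12 * V x ^ 2 - 12 * (U x * V x)) * F 1 x ^ 2
      + (6 * V x ^ 2 + 12 * U x ^ 2) * F 3 x ^ 2 + 12 * (U x ^ 2 * (F 1 x * F 3 x)) := by
    repeat'
      first
        | assumption | apply Integrable.fun_add | apply Integrable.const_mul
        | apply L2Bdd.integrable_mul | apply L2Bdd.sub | apply L2Bdd.add | apply L2Bdd.const_mul
        | apply L2Bdd.mul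
  simp_rw [add_assoc _ ((4 - ω ^ 2) * _)]
  rw [integral_add ((((iG 0).fun_add (iG 1)).fun_add (iG 2)).fun_add (iG 3)) iD,
    integral_add (((iG 0).fun_add (iG 1)).fun_add (iG 2)) (iG 3),
    integral_add ((iG 0).fun_add (iG 1)) (iG 2), integral_add (iG 0) (iG 1)]
  -- Undoing the integration by parts puts both sides under one integral, where the identity holds
  -- almost everywhere.
  have e : ∀ i, ∫ x, G i x ^ 2 = -∫ x, weakDeriv (weakDeriv (h i)) x * F i x := fun i => by
    rw [hK, neg_neg]
  rw [e, e, e, e, ← neg_add, ← neg_add, ← neg_add, ← integral_add (iK 0) (iK 1),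
    ← integral_add ((iK 0).fun_add (iK 1)) (iK 2),
    ← integral_add (((iK 0).fun_add (iK 1)).fun_add (iK 2)) (iK 3), neg_add_eq_sub,
    ← integral_sub iD ((((iK 0).fun_add (iK 1)).fun_add (iK 2)).fun_add (iK 3)),
    ← integral_const_mul,
    ← integral_sub (integrable_fun_sub iD ((((iK 0).fun_add (iK 1)).fun_add (iK 2)).fun_add (iK 3)))
      (iQ.const_mul _)]
  refine integral_congr_ae ?_
  filter_upwards [linOp_ae_eq (ω := ω) (J₀ := J₀) (U := U) (V := V) hF, hF 0, hF 1, hF 2, hF 3]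
    with x hl h0 h1 h2 h3
  simp only [Fin.sum_univ_four]
  rw [hl.1, hl.2.1, hl.2.2.1, hl.2.2.2, h0, h1, h2, h3]
  ring

end Linearization

end Oscillon

/-! ### Assembly -/

theorem proposition1 (ω : ℝ) (hω : |ω| < 2 / 3) :
    ∃ (U V : ℝ → ℝ) (J₀ : ℝ),
      -- `(U, V)` is a maximizer, nonnegative and even
      (Oscillon.toC U, Oscillon.toC V) ∈ Oscillon.admissible ω ∧
      IsGreatest (Oscillon.values ω) (Oscillon.J (Oscillon.toC U) (Oscillon.toC V)) ∧
      (∀ x, 0 ≤ U x) ∧ (∀ x, 0 ≤ V x) ∧ Function.Even U ∧ Function.Even V ∧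
      -- the constant `J₀`
      J₀ = 2 * sSup (Oscillon.values ω) ∧ 0 < J₀ ∧
      -- the Euler–Lagrange system, in the classical sense
      ContDiff ℝ (⊤ : ℕ∞) U ∧ ContDiff ℝ (⊤ : ℕ∞) V ∧
      (∀ x, -deriv (deriv U) x + (4 - ω ^ 2) * U x
        - 1 / J₀ * (6 * U x ^ 3 + 12 * V x ^ 2 * U x + 6 * U x ^ 2 * V x) = 0) ∧
      (∀ x, -deriv (deriv V) x + (4 - 9 * ω ^ 2) * V x
        - 1 / J₀ * (6 * V x ^ 3 + 12 * U x ^ 2 * V x + 2 * U x ^ 3) = 0) ∧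
      -- nonnegativity of the linearized operator on a subspace of codimension one
      (∀ i, MemLp (Oscillon.normalVec ω U V i) 2) ∧
      (∃ i, ¬ Oscillon.normalVec ω U V i =ᵐ[volume] 0) ∧
      (∀ h : Fin 4 → ℝ → ℝ, (∀ i, Oscillon.MemH2 (h i)) →
        Oscillon.inner4 h (Oscillon.normalVec ω U V) = 0 →
        (∀ i, MemLp (Oscillon.linOp ω J₀ U V h i) 2) ∧
        0 ≤ Oscillon.inner4 (Oscillon.linOp ω J₀ U V h) h) := by
  open Oscillon in
  have hω2 : ω ^ 2 < (2 / 3) ^ 2 := sq_lt_sq' (abs_lt.mp hω).1 (abs_lt.mp hω).2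
  have ha : 0 < 4 - ω ^ 2 := by linarith
  have hb : 0 < 4 - 9 * ω ^ 2 := by linarith
  obtain ⟨U, U₁, V, V₁, hU₁, hV₁, hU0, hV0, hE₁, hQ, hUe, hVe⟩ :=
    exists_even_nonneg_maximizer ha hb
  have hM := sSup_values_pos ha hb
  have lU := hU₁.l2Bdd
  have lV := hV₁.l2Bdd
  set J₀ := 2 * sSup (values ω) with hJ₀
  have hJ0 : 0 < J₀ := by positivity
  obtain ⟨wU, wV⟩ := hasWeakDeriv_of_maximizer ha hb hU₁ hV₁ hE₁ hQ hJ₀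
  set P : ℝ → ℝ := fun x => (4 - ω ^ 2) * U x
      - 1 / J₀ * (6 * U x ^ 3 + 12 * (V x ^ 2 * U x) + 6 * (U x ^ 2 * V x)) with hP
  set R : ℝ → ℝ := fun x => (4 - 9 * ω ^ 2) * V x
      - 1 / J₀ * (6 * V x ^ 3 + 12 * (U x ^ 2 * V x) + 2 * U x ^ 3) with hR
  have lP : L2Bdd P := by
    rw [hP]
    repeat'
      first
        | assumption | apply L2Bdd.sub | apply L2Bdd.add | apply L2Bdd.const_mul | apply L2Bdd.mul
  have lR : L2Bdd R := by
    rw [hR]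
    repeat'
      first
        | assumption | apply L2Bdd.sub | apply L2Bdd.add | apply L2Bdd.const_mul | apply L2Bdd.mul
  -- The weak derivative itself lies in `H¹`, so it has a continuous representative, which is then
  -- the classical derivative.
  obtain ⟨U', hU'e, hU'⟩ := wU.exists_isH1 hU₁.memLp_deriv lP.memLp
  obtain ⟨V', hV'e, hV'⟩ := wV.exists_isH1 hV₁.memLp_deriv lR.memLp
  have hU := hU₁.congr_deriv hU'e
  have hV := hV₁.congr_deriv hV'e
  have cU := hU.continuous
  have cV := hV.continuous
  have dU := hU.hasDerivAt hU'.continuous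
  have dV := hV.hasDerivAt hV'.continuous
  have dU' := hU'.hasDerivAt (by fun_prop)
  have dV' := hV'.hasDerivAt (by fun_prop)
  have hE : energy (4 - ω ^ 2) (4 - 9 * ω ^ 2) U U' V V' = 1 := by
    rw [← hE₁, ← I_toC hU hV, ← I_toC hU₁ hV₁]
  have ddU : ∀ x, deriv (deriv U) x = P x := fun x => by
    rw [show deriv U = U' from funext fun y => (dU y).deriv, (dU' x).deriv]
  have ddV : ∀ x, deriv (deriv V) x = R x := fun x => by
    rw [show deriv V = V' from funext fun y => (dV y).deriv, (dV' x).deriv]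
  obtain ⟨sU, sV⟩ := contDiff_of_second_order_system
    (P := fun z => (4 - ω ^ 2) * z.1
      - 1 / J₀ * (6 * z.1 ^ 3 + 12 * (z.2 ^ 2 * z.1) + 6 * (z.1 ^ 2 * z.2)))
    (Q := fun z => (4 - 9 * ω ^ 2) * z.2
      - 1 / J₀ * (6 * z.2 ^ 3 + 12 * (z.1 ^ 2 * z.2) + 2 * z.1 ^ 3))
    (by fun_prop) (by fun_prop) dU dU' dV dV'
  -- By the Euler–Lagrange system `n` is a cubic polynomial in `U, V`: it is in `L²`, and it is the
  -- gradient of `J` divided by `2 * J₀`.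
  have n0 : normalVec ω U V 0 = fun x =>
      1 / J₀ * (6 * U x ^ 3 + 12 * (V x ^ 2 * U x) + 6 * (U x ^ 2 * V x)) := by
    ext x; simp only [normalVec, Matrix.cons_val, ddU, hP]; ring
  have n2 : normalVec ω U V 2 = fun x =>
      1 / J₀ * (6 * V x ^ 3 + 12 * (U x ^ 2 * V x) + 2 * U x ^ 3) := by
    ext x; simp only [normalVec, Matrix.cons_val, ddV, hR]; ring
  have n1 : normalVec ω U V 1 = fun _ => 0 := rfl
  have n3 : normalVec ω U V 3 = fun _ => 0 := rfl
  have hadm : (toC U, toC V) ∈ admissible ω :=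
    ⟨hU.ofReal.memH1_of_ae_eq (ae_eq_refl _), hV.ofReal.memH1_of_ae_eq (ae_eq_refl _),
      (I_toC hU hV).trans hE⟩
  -- the first variation, written with the normal vector
  have first : ∀ p r : ℝ → ℝ,
      ∫ x, ((12 * U x ^ 3 + 24 * (V x ^ 2 * U x) + 12 * (U x ^ 2 * V x)) * p x
        + (12 * V x ^ 3 + 24 * (U x ^ 2 * V x) + 4 * U x ^ 3) * r x)
      = 2 * J₀ * ∫ x, (p x * normalVec ω U V 0 x + r x * normalVec ω U V 2 x) := fun p r => by
    rw [← integral_const_mul]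
    refine integral_congr_ae (ae_of_all _ fun x => ?_)
    simp only [n0, n2]
    field_simp
    ring
  refine ⟨U, V, J₀, hadm, ?_, hU0, hV0, hUe, hVe, hJ₀, hJ0, sU, sV, fun x => ?_, fun x => ?_,
    fun i => ?_, ?_, fun h hh horth => ?_⟩
  · refine ⟨⟨_, hadm, rfl⟩, ?_⟩
    rw [J_toC, hQ]
    exact fun y hy => le_csSup (bddAbove_values ha hb) hy
  · rw [ddU, hP]; ring
  · rw [ddV, hR]; ring
  · have l0 : L2Bdd (normalVec ω U V 0) := by
      rw [n0]
      repeat'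
        first
          | assumption | apply L2Bdd.add | apply L2Bdd.const_mul | apply L2Bdd.mul
    have l2 : L2Bdd (normalVec ω U V 2) := by
      rw [n2]
      repeat'
        first
          | assumption | apply L2Bdd.add | apply L2Bdd.const_mul | apply L2Bdd.mul
    fin_cases i
    · exact l0.memLp
    · exact MemLp.zero'
    · exact l2.memLp
    · exact MemLp.zero'
  -- If `n` vanished, its pairing with `(U, V)` would too; but the first variation in that direction
  -- is `4 * M` times the energy, which is `1`.
  · by_contra! hcon
    have hz : IsH1 (fun _ : ℝ => (0 : ℝ)) (fun _ => 0) := IsH1.zero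
    have h1 := (variation_conditions ha hb hU hV hE hQ hU hz hV hz rfl rfl rfl).1
    have h2 : ∫ x, (U x * normalVec ω U V 0 x + V x * normalVec ω U V 2 x) = 0 := by
      rw [← integral_zero ℝ ℝ]
      refine integral_congr_ae ?_
      filter_upwards [hcon 0, hcon 2] with x h0 h2
      simp [h0, h2]
    rw [first, h2] at h1
    have h3 : ∫ x, (U' x * U' x + V' x * V' x + (4 - ω ^ 2) * (U x * U x)
        + (4 - 9 * ω ^ 2) * (V x * V x)) = 1 := by
      rw [← hE, energy]
      simp only [sq]
    rw [h3] at h1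
    linarith
  · choose F G hF hFG hG using fun i => (hh i).exists_isH1
    refine ⟨memLp_linOp lU lV hF hFG hG, ?_⟩
    rw [inner4_linOp lU lV hF hFG hG]
    obtain ⟨h1, h2⟩ := variation_conditions ha hb hU hV hE hQ (hFG 0) (hFG 1) (hFG 2) (hFG 3)
      rfl rfl rfl
    have h3 : ∫ x, (F 0 x * normalVec ω U V 0 x + F 2 x * normalVec ω U V 2 x) = 0 := by
      rw [← horth]
      refine integral_congr_ae ?_
      filter_upwards [hF 0, hF 2] with x h0 h2
      simp only [Fin.sum_univ_four, n1, n3]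
      rw [h0, h2]; ring
    -- Orthogonality to `n` gives `B = 0`, and the second-order condition reduces to `Q ≤ 2 * M * E
    -- = J₀ * E`.
    rw [first, h3, mul_zero] at h1
    have h4 := (mul_eq_zero.mp h1.symm).resolve_left (by positivity)
    rw [h4] at h2
    rw [sub_nonneg, one_div, inv_mul_le_iff₀ hJ0, hJ₀]
    linarith
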